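/- Let $a<b$ be real numbers and $\Omega=(a,b)$. For every integer $N\ge1$ let $a^N\in\mathbb R$ be arbitrary, put $x^N_m=a^N+m/N$ for $m\in\mathbb Z$ and $\omega^N=\{m\in\mathbb Z : x^N_m\in\Omega\}$ (a finite set), and let $T^N=(T^N_{mn})_{m,n\in\omega^N}$ be the matrix with $T^N_{mm}=0$ and $T^N_{mn}=\frac1{i\pi N}\,\frac1{x^N_m-x^N_n}$ for $m\ne n$, considered as an operator on $\ell^2(\omega^N)$. Then: (1) For every $N$ the matrix $T^N$ is selfadjoint and all its eigenvalues lie in $[-1,1]$. (2) For every $u\in L^2(\Omega)$ the principal value $(A_\Omega u)(x)=\mathrm{p.v.}\!\int_\Omega\frac{u(y)}{i\pi(x-y)}\,dy=\lim_{\varepsilon\to0+}\int_{\{y\in\Omega:\,|x-y|>\varepsilon\}}\frac{u(y)}{i\pi(x-y)}\,dy$ exists for almost every $x\in\Omega$, and this defines a bounded linear operator $A_\Omega$ on $L^2(\Omega)$. For $\lambda\in\mathbb C$, call the scheme $(\lambda-T^N)U^N=F^N$ $\ell^2$-stable if there is a constant $C$ such that, for all $N\ge1$, $\lambda-T^N$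 is invertible and $\|(\lambda-T^N)^{-1}\|_{\mathcal L(\ell^2(\omega^N))}\le C$. Then for every $\lambda\in\mathbb C$ the scheme is $\ell^2$-stable if and only if $\lambda-A_\Omega$ is boundedly invertible on $L^2(\Omega)$, and this holds if and only if $\lambda\notin[-1,1]$. (3) For every $\lambda\in\mathbb C\setminus[-1,1]$ and every $N\ge1$, $\lambda-T^N$ and $\lambda-A_\Omega$ are invertible and $$\|(\lambda-T^N)^{-1}\|_{\mathcal L(\ell^2(\omega^N))}\le\mathrm{dist}(\lambda,[-1,1])^{-1}=\|(\lambda-A_\Omega)^{-1}\|_{\mathcal L(L^2(\Omega))}.$$ -/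

import Mathlib

open MeasureTheory Set Filter Topology

noncomputable section

/-- The complex Hilbert space `L²(Ω)`, where `Ω = (a, b)`. -/
abbrev L2Interval (a b : ℝ) : Type :=
  Lp ℂ 2 ((volume : Measure ℝ).restrict (Ioo a b))

/-- The integral `∫ u(y) / (iπ (x - y)) dy` over those `y ∈ (a, b)` with `|x - y| > ε`. -/
def truncatedHilbert (a b : ℝ) (u : ℝ → ℂ) (ε x : ℝ) : ℂ :=
  ∫ y in {y : ℝ | y ∈ Ioo a b ∧ ε < |x - y|},
    u y / (Complex.I * (Real.pi : ℂ) * ((x : ℂ) - (y : ℂ)))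

/-- The principal value integral `p.v. ∫ u(y) / (iπ (x - y)) dy` over `(a, b)` exists
and equals `v`. -/
def HasPrincipalValue (a b : ℝ) (u : ℝ → ℂ) (x : ℝ) (v : ℂ) : Prop :=
  Tendsto (fun ε : ℝ => truncatedHilbert a b u ε x) (𝓝[>] 0) (𝓝 v)

/-- `A` is the finite Hilbert transformation `A_Ω` on `L²(Ω)`, `Ω = (a, b)`: for every
`u ∈ L²(Ω)` and almost every `x ∈ Ω` the principal value exists and is equal to `(A u)(x)`. -/
def IsFiniteHilbertTransform (a b : ℝ) (A : L2Interval a b →L[ℂ] L2Interval a b) : Prop :=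
  ∀ u : L2Interval a b, ∀ᵐ x ∂((volume : Measure ℝ).restrict (Ioo a b)),
    HasPrincipalValue a b u x (A u x)

/-- There is at most one finite Hilbert transformation on `L²(Ω)`. -/
theorem IsFiniteHilbertTransform.unique {a b : ℝ} {A B : L2Interval a b →L[ℂ] L2Interval a b}
    (hA : IsFiniteHilbertTransform a b A) (hB : IsFiniteHilbertTransform a b B) : A = B := by
  ext u
  filter_upwards [hA u, hB u] with x h₁ h₂
  exact tendsto_nhds_unique h₁ h₂

/-- The grid point `x_m = o + m h` of the grid of mesh width `h = 1 / N` and origin `o`. -/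
def gridPoint (o : ℝ) (N : ℕ+) (m : ℤ) : ℝ :=
  o + (m : ℝ) * (1 / ((N : ℕ) : ℝ))

/-- The set of the integers `m` such that the grid point `x_m` lies in `(a, b)`. -/
def gridIndex (a b o : ℝ) (N : ℕ+) : Set ℤ :=
  {m : ℤ | gridPoint o N m ∈ Ioo a b}

theorem gridIndex_finite (a b o : ℝ) (N : ℕ+) : (gridIndex a b o N).Finite := by
  have hN : (0 : ℝ) < ((N : ℕ) : ℝ) := by exact_mod_cast N.pos
  refine (Set.finite_Icc ⌊(a - o) * ((N : ℕ) : ℝ)⌋ ⌈(b - o) * ((N : ℕ) : ℝ)⌉).subset ?_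
  rintro m ⟨h₁, h₂⟩
  have h₃ : (a - o) * ((N : ℕ) : ℝ) < (m : ℝ) := by
    have := mul_lt_mul_of_pos_right (sub_lt_iff_lt_add'.2 h₁) hN
    rwa [mul_assoc, one_div, inv_mul_cancel₀ hN.ne', mul_one] at this
  have h₄ : (m : ℝ) < (b - o) * ((N : ℕ) : ℝ) := by
    have := mul_lt_mul_of_pos_right (lt_sub_iff_add_lt'.2 h₂) hN
    rwa [mul_assoc, one_div, inv_mul_cancel₀ hN.ne', mul_one] at this
  constructor
  · exact_mod_cast (Int.floor_le _).trans h₃.le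
  · exact_mod_cast h₄.le.trans (Int.le_ceil _)

instance gridIndexFintype (a b o : ℝ) (N : ℕ+) : Fintype (gridIndex a b o N) :=
  (gridIndex_finite a b o N).fintype

/-- The system matrix `T^N` of the delta-delta scheme
`λ u_m - (1 / (iπN)) ∑_{n ≠ m} u_n / (x_m - x_n) = f(x_m)`. -/
def schemeMatrix (a b o : ℝ) (N : ℕ+) :
    Matrix (gridIndex a b o N) (gridIndex a b o N) ℂ :=
  fun m n => if m = n then 0 else
    1 / (Complex.I * (Real.pi : ℂ) * ((N : ℕ) : ℂ)) *
      (1 / ((gridPoint o N m : ℂ) - (gridPoint o N n : ℂ)))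

/-- The matrix `T^N` as an operator on `ℓ²(ω^N)`. -/
def schemeOperator (a b o : ℝ) (N : ℕ+) :
    EuclideanSpace ℂ (gridIndex a b o N) →L[ℂ] EuclideanSpace ℂ (gridIndex a b o N) :=
  Matrix.toEuclideanCLM (𝕜 := ℂ) (schemeMatrix a b o N)

/-- The interval `[-1, 1]` as a subset of the complex plane. -/
def unitSegment : Set ℂ := Complex.ofReal '' Icc (-1 : ℝ) 1

/-- Stability of the scheme in the `ℓ²` norm, the grid for `N` having the origin `o N`: the
operators `λ - T^N` are invertible, with inverses bounded uniformly in `N`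
(`resolvent T lam` is the inverse of `lam - T`). -/
def IsStableScheme (a b : ℝ) (o : ℕ+ → ℝ) (lam : ℂ) : Prop :=
  ∃ C : ℝ, ∀ N : ℕ+,
    IsUnit (algebraMap ℂ _ lam - schemeOperator a b (o N) N) ∧
      ‖resolvent (schemeOperator a b (o N) N) lam‖ ≤ C

end

/-!
Both halves of the argument realize the operators as compressions of a concrete operator of norm
at most `1`.

*The scheme.* The grid origin and mesh width cancel from `T^N`, whose entries are
`1 / (iπ (m - n))`. These are the Fourier coefficients of the sawtooth `1 - 2 x` on the circle, so
`T^N` is the compression to a space of trigonometric polynomials of the multiplication by a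
function with values in `[-1, 1]`. Hence `T^N` is a symmetric contraction, and a bound on the
numerical range (`infDist_mul_norm_sq_le`) gives the resolvent estimate. Conversely, since
`‖(lam - T^N) u‖` is at most the norm of `(lam - M) u` for the multiplication operator `M`, and
since frequency shifts commute with `M`, a stability bound passes to `lam - M`
(`norm_le_mul_norm_sub_sawtoothMul`); indicators of arcs show that this is impossible for `lam` in
`[-1, 1]`.

*The integral operator.* On the line, Cauchy kernels `1 / (y - w)` with poles in opposite half
planes are orthogonal in `L²`. The reflection `lineHilbert` in the closed span of one of the two
families therefore acts as `1` on one and as `-1` on the other, and its compression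
`finiteHilbert` to `(a, b)` is a symmetric contraction. That it is given by principal
values almost everywhere uses no maximal function: by duality, the Poisson integral of
`lineHilbert f` is the conjugate Poisson integral of `f`; at Lebesgue points the former converges
(`IsPoissonPoint.tendsto_cauchyTransform_sub`), and the latter differs from the truncated singular
integral by a quantity tending to zero (`IsPoissonPoint.tendsto_truncated_add`).

*Its spectrum.* For `u(y) = ((y - a) / (b - y)) ^ s` with `-1/2 < Re s < 0` the Cauchy integral is
a multiple of `((z - a) / (z - b)) ^ s - 1`, by a substitution and a Stieltjes transform. Its
boundary values show that `finiteHilbert` maps `u` to `-i cot(πs) u` plus a constant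
(`finiteHilbert_edgePow`). As `s → -1/2 + iξ` the norm of `u` blows up while the constant stays
bounded, so `-tanh(πξ)` is an approximate eigenvalue; these values are dense in `[-1, 1]`.
-/

/-! ### Resolvents of contractions with real quadratic form -/

theorem isCompact_unitSegment : IsCompact unitSegment :=
  isCompact_Icc.image Complex.continuous_ofReal

theorem unitSegment_nonempty : unitSegment.Nonempty :=
  ⟨_, mem_image_of_mem _ (left_mem_Icc.2 (by norm_num))⟩

theorem infDist_unitSegment_pos {lam : ℂ} (h : lam ∉ unitSegment) :
    0 < Metric.infDist lam unitSegment :=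
  (isCompact_unitSegment.isClosed.notMem_iff_infDist_pos unitSegment_nonempty).1 h

section Resolvent

variable {H : Type*} [NormedAddCommGroup H] [InnerProductSpace ℂ H]

/-- The numerical range of a symmetric contraction `T` lies in `[-1, 1]`, so that of `lam - T`
keeps the distance of `lam` from the segment away from `0`. -/
theorem infDist_mul_norm_sq_le {T : H →L[ℂ] H} (hsymm : T.IsSymmetric) (hnorm : ‖T‖ ≤ 1)
    (lam : ℂ) (u : H) :
    ‖u‖ ^ 2 * Metric.infDist lam unitSegment ≤
      ‖inner ℂ ((algebraMap ℂ (H →L[ℂ] H) lam - T) u) u‖ := by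
  rcases eq_or_ne u 0 with rfl | hu
  · simp
  have hu0 : 0 < ‖u‖ ^ 2 := by positivity
  obtain ⟨t, ht⟩ : ∃ t : ℝ, inner ℂ (T u) u = (t : ℂ) := by
    have h := hsymm u u
    refine ⟨(inner ℂ (T u) u).re, ?_⟩
    have h2 : (starRingEnd ℂ) (inner ℂ (T u) u) = inner ℂ (T u) u := by
      rw [inner_conj_symm]; exact h.symm
    exact (Complex.conj_eq_iff_re.1 h2).symm
  have ht1 : |t| ≤ ‖u‖ ^ 2 := by
    have h1 : ‖inner ℂ (T u) u‖ ≤ ‖u‖ ^ 2 :=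
      calc ‖inner ℂ (T u) u‖ ≤ ‖T u‖ * ‖u‖ := norm_inner_le_norm _ _
        _ ≤ (1 * ‖u‖) * ‖u‖ := by gcongr; exact T.le_of_opNorm_le hnorm u
        _ = ‖u‖ ^ 2 := by ring
    rwa [ht, Complex.norm_real, Real.norm_eq_abs] at h1
  have hmem : ((t / ‖u‖ ^ 2 : ℝ) : ℂ) ∈ unitSegment := by
    refine mem_image_of_mem _ ⟨?_, ?_⟩
    · rw [le_div_iff₀ hu0]; linarith [neg_abs_le t]
    · rw [div_le_one hu0]; linarith [le_abs_self t]
  have hinner : inner ℂ ((algebraMap ℂ (H →L[ℂ] H) lam - T) u) u =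
      (‖u‖ ^ 2 : ℝ) * ((starRingEnd ℂ) lam - ((t / ‖u‖ ^ 2 : ℝ) : ℂ)) := by
    have h3 : (algebraMap ℂ (H →L[ℂ] H) lam - T) u = lam • u - T u := by
      simp [Algebra.algebraMap_eq_smul_one]
    rw [h3, inner_sub_left, inner_smul_left, ht, inner_self_eq_norm_sq_to_K]
    have : ((‖u‖ : ℝ) : ℂ) ≠ 0 := by simpa using hu
    push_cast
    field_simp
    simp
  rw [hinner, norm_mul, Complex.norm_real, Real.norm_of_nonneg hu0.le]
  gcongr
  calc Metric.infDist lam unitSegment ≤ dist lam ((t / ‖u‖ ^ 2 : ℝ) : ℂ) :=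
        Metric.infDist_le_dist_of_mem hmem
    _ = ‖(starRingEnd ℂ) lam - ((t / ‖u‖ ^ 2 : ℝ) : ℂ)‖ := by
        rw [dist_eq_norm, ← RCLike.norm_conj, map_sub, Complex.conj_ofReal]

theorem isUnit_algebraMap_sub_of_notMem [CompleteSpace H] {T : H →L[ℂ] H}
    (hsymm : T.IsSymmetric) (hnorm : ‖T‖ ≤ 1)
    {lam : ℂ} (hlam : lam ∉ unitSegment) : IsUnit (algebraMap ℂ (H →L[ℂ] H) lam - T) :=
  ContinuousLinearMap.isUnit_of_forall_le_norm_inner_map _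
    (c := ⟨_, (infDist_unitSegment_pos hlam).le⟩) (infDist_unitSegment_pos hlam)
    (infDist_mul_norm_sq_le hsymm hnorm lam)

theorem resolvent_apply_sub {T : H →L[ℂ] H} {lam : ℂ}
    (h : IsUnit (algebraMap ℂ (H →L[ℂ] H) lam - T)) (u : H) :
    resolvent T lam ((algebraMap ℂ (H →L[ℂ] H) lam - T) u) = u := by
  have := Ring.inverse_mul_cancel _ h
  exact congrArg (fun S : H →L[ℂ] H => S u) this

theorem sub_apply_resolvent {T : H →L[ℂ] H} {lam : ℂ}
    (h : IsUnit (algebraMap ℂ (H →L[ℂ] H) lam - T)) (u : H) :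
    (algebraMap ℂ (H →L[ℂ] H) lam - T) (resolvent T lam u) = u := by
  have := Ring.mul_inverse_cancel _ h
  exact congrArg (fun S : H →L[ℂ] H => S u) this

theorem norm_le_norm_resolvent_mul {T : H →L[ℂ] H} {lam : ℂ}
    (h : IsUnit (algebraMap ℂ (H →L[ℂ] H) lam - T)) (u : H) :
    ‖u‖ ≤ ‖resolvent T lam‖ * ‖(algebraMap ℂ (H →L[ℂ] H) lam - T) u‖ := by
  conv_lhs => rw [← resolvent_apply_sub h u]
  exact (resolvent T lam).le_opNorm _

theorem norm_resolvent_le_inv_infDist [CompleteSpace H] {T : H →L[ℂ] H}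
    (hsymm : T.IsSymmetric) (hnorm : ‖T‖ ≤ 1)
    {lam : ℂ} (hlam : lam ∉ unitSegment) :
    ‖resolvent T lam‖ ≤ (Metric.infDist lam unitSegment)⁻¹ := by
  have hd := infDist_unitSegment_pos hlam
  refine ContinuousLinearMap.opNorm_le_bound _ (by positivity) fun v => ?_
  have hv := sub_apply_resolvent (isUnit_algebraMap_sub_of_notMem hsymm hnorm hlam) v
  have h1 := infDist_mul_norm_sq_le hsymm hnorm lam (resolvent T lam v)
  rw [hv] at h1
  have h2 := h1.trans (norm_inner_le_norm _ _)
  rw [inv_mul_eq_div, le_div_iff₀ hd]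
  rcases (norm_nonneg (resolvent T lam v)).eq_or_lt with h0 | h0
  · rw [← h0]; simp
  · nlinarith

/-- The resolvent blows up at least like the inverse distance from the spectrum. -/
theorem inv_norm_sub_le_norm_resolvent [CompleteSpace H] {T : H →L[ℂ] H} {lam μ : ℂ}
    (hlam : IsUnit (algebraMap ℂ (H →L[ℂ] H) lam - T)) (hμ : μ ∈ spectrum ℂ T) :
    ‖lam - μ‖⁻¹ ≤ ‖resolvent T lam‖ := by
  by_contra! hlt
  refine hμ ?_
  rw [spectrum.mem_resolventSet_iff]
  have hne : lam ≠ μ := by rintro rfl; exact hμ hlam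
  have hpos : 0 < ‖lam - μ‖ := norm_pos_iff.2 (sub_ne_zero.2 hne)
  have hs : ‖(lam - μ) • resolvent T lam‖ < 1 := by
    rw [norm_smul]
    calc ‖lam - μ‖ * ‖resolvent T lam‖ < ‖lam - μ‖ * ‖lam - μ‖⁻¹ := by gcongr
      _ = 1 := mul_inv_cancel₀ hpos.ne'
  have hfac : algebraMap ℂ (H →L[ℂ] H) μ - T =
      (algebraMap ℂ (H →L[ℂ] H) lam - T) * (1 - (lam - μ) • resolvent T lam) := by
    have h1 : (algebraMap ℂ (H →L[ℂ] H) lam - T) * resolvent T lam = 1 :=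
      Ring.mul_inverse_cancel _ hlam
    rw [mul_sub, mul_one, mul_smul_comm, h1, sub_smul, Algebra.algebraMap_eq_smul_one,
      Algebra.algebraMap_eq_smul_one]
    abel
  rw [hfac]
  exact hlam.mul (isUnit_one_sub_of_norm_lt_one hs)

theorem inv_infDist_le_norm_resolvent [CompleteSpace H] {T : H →L[ℂ] H} {lam : ℂ}
    (hlam : IsUnit (algebraMap ℂ (H →L[ℂ] H) lam - T)) (hT : unitSegment ⊆ spectrum ℂ T) :
    (Metric.infDist lam unitSegment)⁻¹ ≤ ‖resolvent T lam‖ := by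
  obtain ⟨μ, hμ, hd⟩ := isCompact_unitSegment.exists_infDist_eq_dist unitSegment_nonempty lam
  rw [hd, dist_eq_norm]
  exact inv_norm_sub_le_norm_resolvent hlam (hT hμ)

end Resolvent

/-! ### Multiplication operators and the symbol of the scheme -/

section Multiplication

variable {α : Type*} {m : MeasurableSpace α} {μ : Measure α}

/-- Multiplication by a bounded function `g` as an operator on `L²`. -/
noncomputable def mulLp (g : Lp ℂ ⊤ μ) : Lp ℂ 2 μ →L[ℂ] Lp ℂ 2 μ :=
  (ContinuousLinearMap.mul ℂ ℂ).holderL μ ⊤ 2 2 g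

theorem coeFn_mulLp (g : Lp ℂ ⊤ μ) (f : Lp ℂ 2 μ) : mulLp g f =ᵐ[μ] fun x => g x * f x :=
  (ContinuousLinearMap.mul ℂ ℂ).coeFn_holder (r := 2) g f

theorem mulLp_comm (g h : Lp ℂ ⊤ μ) (f : Lp ℂ 2 μ) :
    mulLp g (mulLp h f) = mulLp h (mulLp g f) := by
  ext1
  filter_upwards [coeFn_mulLp g (mulLp h f), coeFn_mulLp h (mulLp g f), coeFn_mulLp g f,
    coeFn_mulLp h f] with x h1 h2 h3 h4
  rw [h1, h2, h3, h4]
  ring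

theorem norm_mulLp_apply_eq {g : Lp ℂ ⊤ μ} (f : Lp ℂ 2 μ) (h : ∀ᵐ x ∂μ, ‖g x‖ = 1) :
    ‖mulLp g f‖ = ‖f‖ := by
  rw [Lp.norm_def, Lp.norm_def]
  congr 1
  refine eLpNorm_congr_norm_ae ?_
  filter_upwards [coeFn_mulLp g f, h] with x h1 h2
  rw [h1, norm_mul, h2, one_mul]

end Multiplication

/-- The sawtooth `x ↦ 1 - 2 x` on `[0, 1)`, as a function on the circle: the symbol of the
Toeplitz matrices `T^N`. -/
noncomputable def sawtooth (x : UnitAddCircle) : ℂ := -2 * (periodizedBernoulli 1 x : ℂ)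

theorem sawtooth_coe {x : ℝ} (hx : x ∈ Ico (0 : ℝ) 1) :
    sawtooth (x : UnitAddCircle) = 1 - 2 * x := by
  have h : periodizedBernoulli 1 (x : UnitAddCircle) = bernoulliFun 1 x := by
    rw [periodizedBernoulli, AddCircle.liftIco_coe_apply (by simpa using hx)]
  rw [sawtooth, h, bernoulliFun_one]
  push_cast
  ring

theorem exists_coe_eq_Ico (y : UnitAddCircle) : ∃ x ∈ Ico (0 : ℝ) 1, (x : UnitAddCircle) = y := by
  obtain ⟨x, hx, rfl⟩ := (AddCircle.coe_image_Ico_eq (1 : ℝ) 0).symm ▸ mem_univ y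
  exact ⟨x, by simpa using hx, rfl⟩

theorem norm_sawtooth_le (y : UnitAddCircle) : ‖sawtooth y‖ ≤ 1 := by
  obtain ⟨x, hx, rfl⟩ := exists_coe_eq_Ico y
  rw [sawtooth_coe hx]
  have : (1 - 2 * x : ℂ) = ((1 - 2 * x : ℝ) : ℂ) := by push_cast; ring
  rw [this, Complex.norm_real, Real.norm_eq_abs, abs_le]
  constructor <;> linarith [hx.1, hx.2]

theorem measurable_sawtooth : Measurable sawtooth := by
  have h : Measurable (periodizedBernoulli 1) := by
    have : periodizedBernoulli 1 = fun y : UnitAddCircle =>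
        bernoulliFun 1 (AddCircle.measurableEquivIco 1 0 y : ℝ) := by
      ext y; rfl
    rw [this]
    exact (Polynomial.continuous _).measurable.comp
      (measurable_subtype_coe.comp (AddCircle.measurableEquivIco (1 : ℝ) 0).measurable)
  exact (Complex.measurable_ofReal.comp h).const_mul _

/-- For `k = 0` both sides vanish, the right one as `1 / 0`. -/
theorem fourierCoeff_sawtooth (k : ℤ) :
    fourierCoeff sawtooth k = 1 / (Complex.I * Real.pi * k) := by
  have h := fourierCoeff_bernoulli_eq one_ne_zero k
  have h2 : sawtooth = (-2 : ℂ) • ((fun x : ℝ => (x : ℂ)) ∘ periodizedBernoulli 1) := by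
    ext y; simp [sawtooth]
  rw [h2, fourierCoeff.const_smul]
  erw [h]
  rcases eq_or_ne (k : ℂ) 0 with hk | hk
  · simp [hk]
  · have := Real.pi_ne_zero
    have := Complex.I_ne_zero
    simp only [smul_eq_mul, Nat.factorial_one, Nat.cast_one, pow_one]
    field_simp

local notation "L2Circle" => Lp ℂ 2 (@AddCircle.haarAddCircle 1 _)

theorem memLp_top_sawtooth : MemLp sawtooth ⊤ (@AddCircle.haarAddCircle 1 _) :=
  memLp_top_of_bound measurable_sawtooth.aestronglyMeasurable 1 (.of_forall norm_sawtooth_le)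

/-- Multiplication by the sawtooth: the Laurent operator whose sections are the `T^N`. -/
noncomputable def sawtoothMul : L2Circle →L[ℂ] L2Circle := mulLp memLp_top_sawtooth.toLp

theorem coeFn_sawtoothMul (f : L2Circle) :
    sawtoothMul f =ᵐ[AddCircle.haarAddCircle] fun x => sawtooth x * f x := by
  filter_upwards [coeFn_mulLp memLp_top_sawtooth.toLp f, memLp_top_sawtooth.coeFn_toLp] with x h1 h2
  rw [sawtoothMul, h1, h2]

theorem norm_sawtoothMul_apply_le (f : L2Circle) : ‖sawtoothMul f‖ ≤ ‖f‖ := by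
  refine Lp.norm_le_norm_of_ae_le ?_
  filter_upwards [coeFn_sawtoothMul f] with x h1
  rw [h1, norm_mul]
  exact mul_le_of_le_one_left (norm_nonneg _) (norm_sawtooth_le x)

theorem inner_fourierLp_sawtoothMul (m n : ℤ) :
    inner ℂ (fourierLp 2 m : L2Circle) (sawtoothMul (fourierLp 2 n)) =
      1 / (Complex.I * Real.pi * ((m - n : ℤ) : ℂ)) := by
  rw [← fourierCoeff_sawtooth, L2.inner_def, fourierCoeff]
  refine integral_congr_ae ?_
  filter_upwards [coeFn_sawtoothMul (fourierLp 2 n), coeFn_fourierLp 2 m, coeFn_fourierLp 2 n]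
    with x h1 h2 h3
  rw [h1, h2, h3]
  simp only [RCLike.inner_apply, smul_eq_mul]
  rw [neg_sub, sub_eq_add_neg, fourier_add, fourier_neg]
  ring

/-- The shift on the Fourier side: multiplication by the character of index `k`. -/
noncomputable def characterMul (k : ℤ) : L2Circle →L[ℂ] L2Circle := mulLp (fourierLp ⊤ k)

theorem norm_characterMul_apply (k : ℤ) (f : L2Circle) : ‖characterMul k f‖ = ‖f‖ := by
  refine norm_mulLp_apply_eq f ?_
  filter_upwards [coeFn_fourierLp ⊤ k] with x h1
  rw [h1]
  exact Circle.norm_coe _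

theorem characterMul_fourierLp (k n : ℤ) :
    characterMul k (fourierLp 2 n) = (fourierLp 2 (n + k) : L2Circle) := by
  ext1
  filter_upwards [coeFn_mulLp (fourierLp ⊤ k) (fourierLp 2 n), coeFn_fourierLp ⊤ k,
    coeFn_fourierLp 2 n, coeFn_fourierLp 2 (n + k)] with x h1 h2 h3 h4
  rw [characterMul, h1, h2, h3, h4, fourier_add, mul_comm]

theorem norm_sub_sawtoothMul_characterMul (lam : ℂ) (k : ℤ) (f : L2Circle) :
    ‖lam • characterMul k f - sawtoothMul (characterMul k f)‖ = ‖lam • f - sawtoothMul f‖ := by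
  have h : sawtoothMul (characterMul k f) = characterMul k (sawtoothMul f) := mulLp_comm _ _ _
  rw [h, ← map_smul, ← map_sub, norm_characterMul_apply]

/-- Every point of `[-1, 1]` is an approximate eigenvalue of the multiplication by the sawtooth,
the approximate eigenvectors being indicators of arcs. -/
theorem exists_norm_sub_sawtoothMul_le {lam : ℂ} (hlam : lam ∈ unitSegment) {δ : ℝ} (hδ : 0 < δ) :
    ∃ f : L2Circle, f ≠ 0 ∧ ‖lam • f - sawtoothMul f‖ ≤ δ * ‖f‖ := by
  obtain ⟨t, ht, rfl⟩ := hlam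
  set S : Set UnitAddCircle := {x | ‖(t : ℂ) - sawtooth x‖ ≤ δ} with hS
  have hSm : MeasurableSet S :=
    measurableSet_le (measurable_const.sub measurable_sawtooth).norm measurable_const
  have hSpos : 0 < (@AddCircle.haarAddCircle 1 _) S := by
    set U : Set ℝ := Ioo 0 1 ∩ Ioo ((1 - t) / 2 - δ / 2) ((1 - t) / 2 + δ / 2) with hU
    have hUo : IsOpen ((fun x : ℝ => (x : UnitAddCircle)) '' U) :=
      QuotientAddGroup.isOpenMap_coe _ (isOpen_Ioo.inter isOpen_Ioo)
    have hUne : U.Nonempty := by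
      rw [hU, Ioo_inter_Ioo, nonempty_Ioo]
      simp only [sup_lt_iff, lt_inf_iff]
      refine ⟨⟨by norm_num, ?_⟩, ?_, ?_⟩ <;> linarith [ht.1, ht.2]
    refine (hUo.measure_pos _ (hUne.image _)).trans_le (measure_mono ?_)
    rintro _ ⟨x, ⟨hx1, hx2⟩, rfl⟩
    change ‖(t : ℂ) - sawtooth (x : UnitAddCircle)‖ ≤ δ
    rw [sawtooth_coe ⟨hx1.1.le, hx1.2⟩]
    have : (t : ℂ) - (1 - 2 * x) = ((t - (1 - 2 * x) : ℝ) : ℂ) := by push_cast; ring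
    rw [this, Complex.norm_real, Real.norm_eq_abs, abs_le]
    constructor <;> linarith [hx2.1, hx2.2]
  refine ⟨indicatorConstLp 2 hSm (measure_ne_top _ _) (1 : ℂ), ?_, ?_⟩
  · rw [← norm_ne_zero_iff, norm_indicatorConstLp two_ne_zero (by simp)]
    simp only [norm_one, one_mul]
    have : 0 < (@AddCircle.haarAddCircle 1 _).real S :=
      ENNReal.toReal_pos hSpos.ne' (measure_ne_top _ _)
    positivity
  · set f : L2Circle := indicatorConstLp 2 hSm (measure_ne_top _ _) (1 : ℂ)
    refine Lp.norm_le_mul_norm_of_ae_le_mul ?_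
    filter_upwards [coeFn_sawtoothMul f, Lp.coeFn_sub ((t : ℂ) • f) (sawtoothMul f),
      Lp.coeFn_smul (t : ℂ) f,
      indicatorConstLp_coeFn (p := 2) (hs := hSm) (hμs := measure_ne_top _ _) (c := (1 : ℂ))]
      with x h1 h2 h3 h4
    rw [h2, Pi.sub_apply, h1, h3, Pi.smul_apply, smul_eq_mul, ← sub_mul, norm_mul]
    by_cases hx : x ∈ S
    · gcongr
      exact hx
    · have : f x = 0 := by rw [h4, indicator_of_notMem hx]
      simp [this]

/-! ### The matrices of the scheme as Toeplitz sections -/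

section Scheme

variable (a b o : ℝ) (N : ℕ+)

/-- The mesh width and the origin cancel: `T^N` is a section of a fixed Toeplitz matrix. The
diagonal entries come out as `1 / 0 = 0`. -/
theorem schemeMatrix_apply (m n : gridIndex a b o N) :
    schemeMatrix a b o N m n = 1 / (Complex.I * Real.pi * (((m : ℤ) - (n : ℤ) : ℤ) : ℂ)) := by
  rw [schemeMatrix]
  split_ifs with h
  · simp [h]
  · have hN : ((N : ℕ) : ℂ) ≠ 0 := by exact_mod_cast N.ne_zero
    have hmn : ((m : ℤ) : ℂ) - ((n : ℤ) : ℂ) ≠ 0 := by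
      rw [sub_ne_zero]; exact_mod_cast fun h' => h (Subtype.ext h')
    have h2 : (gridPoint o N m : ℂ) - (gridPoint o N n : ℂ) =
        (((m : ℤ) : ℂ) - ((n : ℤ) : ℂ)) / ((N : ℕ) : ℂ) := by
      simp only [gridPoint]
      push_cast
      ring
    rw [h2]
    push_cast
    field_simp

theorem isHermitian_schemeMatrix : (schemeMatrix a b o N).IsHermitian := by
  ext m n
  rw [Matrix.conjTranspose_apply, schemeMatrix_apply, schemeMatrix_apply]
  simp only [Complex.star_def, map_div₀, map_one, map_mul, Complex.conj_I, Complex.conj_ofReal,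
    map_intCast]
  push_cast
  rw [neg_mul, neg_mul, ← mul_neg, neg_sub]

theorem isSymmetric_schemeOperator : (schemeOperator a b o N).IsSymmetric :=
  Matrix.isSymmetric_toEuclideanLin_iff.2 (isHermitian_schemeMatrix a b o N)

/-- The embedding of `ℓ²(ω^N)` into `L²` of the circle as trigonometric polynomials. -/
noncomputable def trigPoly (u : EuclideanSpace ℂ (gridIndex a b o N)) : L2Circle :=
  ∑ n, u n • fourierLp 2 (n : ℤ)

variable {a b o N}

theorem orthonormal_fourier_gridIndex :
    Orthonormal ℂ (fun n : gridIndex a b o N => (fourierLp 2 (n : ℤ) : L2Circle)) :=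
  orthonormal_fourier.comp _ Subtype.val_injective

theorem inner_trigPoly (u v : EuclideanSpace ℂ (gridIndex a b o N)) :
    inner ℂ (trigPoly a b o N v) (trigPoly a b o N u) = inner ℂ v u := by
  rw [trigPoly, trigPoly, orthonormal_fourier_gridIndex.inner_sum]
  simp [PiLp.inner_apply, mul_comm]

theorem norm_trigPoly (u : EuclideanSpace ℂ (gridIndex a b o N)) :
    ‖trigPoly a b o N u‖ = ‖u‖ := by
  have h := inner_trigPoly u u
  rw [inner_self_eq_norm_sq_to_K, inner_self_eq_norm_sq_to_K] at h
  have h2 : ‖trigPoly a b o N u‖ ^ 2 = ‖u‖ ^ 2 := by exact_mod_cast h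
  exact (pow_left_inj₀ (norm_nonneg _) (norm_nonneg _) two_ne_zero).1 h2

theorem inner_trigPoly_sawtoothMul (u v : EuclideanSpace ℂ (gridIndex a b o N)) :
    inner ℂ (trigPoly a b o N v) (sawtoothMul (trigPoly a b o N u)) =
      inner ℂ v (schemeOperator a b o N u) := by
  simp only [trigPoly, map_sum, map_smul, sum_inner, inner_sum, inner_smul_left, inner_smul_right,
    inner_fourierLp_sawtoothMul, PiLp.inner_apply, Finset.mul_sum]
  rw [Finset.sum_comm]
  refine Finset.sum_congr rfl fun m _ => ?_
  have h : (schemeOperator a b o N u) m =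
      ∑ n : gridIndex a b o N, schemeMatrix a b o N m n * u n := rfl
  simp only [RCLike.inner_apply]
  rw [h, Finset.sum_mul]
  refine Finset.sum_congr rfl fun m _ => ?_
  rw [schemeMatrix_apply]
  ring

/-- `lam - T^N` is a compression of `lam - M`, `M` being the multiplication by the sawtooth. -/
theorem norm_sub_schemeOperator_le (lam : ℂ) (u : EuclideanSpace ℂ (gridIndex a b o N)) :
    ‖lam • u - schemeOperator a b o N u‖ ≤
      ‖lam • trigPoly a b o N u - sawtoothMul (trigPoly a b o N u)‖ := by
  set w := lam • u - schemeOperator a b o N u with hw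
  have h : inner ℂ w w = inner ℂ (trigPoly a b o N w)
      (lam • trigPoly a b o N u - sawtoothMul (trigPoly a b o N u)) := by
    conv_rhs => rw [inner_sub_right, inner_smul_right, inner_trigPoly, inner_trigPoly_sawtoothMul,
      ← inner_smul_right, ← inner_sub_right]
  have h2 : ‖w‖ ^ 2 ≤ ‖w‖ * ‖lam • trigPoly a b o N u - sawtoothMul (trigPoly a b o N u)‖ := by
    have h3 := norm_inner_le_norm (𝕜 := ℂ) (trigPoly a b o N w)
      (lam • trigPoly a b o N u - sawtoothMul (trigPoly a b o N u))
    rw [← h, norm_trigPoly, inner_self_eq_norm_sq_to_K] at h3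
    simpa using h3
  rcases (norm_nonneg w).eq_or_lt with h0 | h0
  · rw [← h0]; positivity
  · nlinarith

theorem norm_schemeOperator_le : ‖schemeOperator a b o N‖ ≤ 1 := by
  refine ContinuousLinearMap.opNorm_le_bound _ zero_le_one fun u => ?_
  have h := norm_sub_schemeOperator_le 0 u
  simp only [zero_smul, zero_sub, norm_neg] at h
  rw [one_mul, ← norm_trigPoly u]
  exact h.trans (norm_sawtoothMul_apply_le _)

end Scheme

/-- The index sets `ω^N` contain arbitrarily long intervals, whatever the origins of the grids. -/
theorem exists_forall_add_mem_gridIndex {a b : ℝ} (hab : a < b) (o : ℕ+ → ℝ) (K : ℕ) :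
    ∃ (N : ℕ+) (k : ℤ), ∀ j : ℤ, |j| ≤ K → j + k ∈ gridIndex a b (o N) N := by
  obtain ⟨n, hn⟩ := exists_nat_gt (2 * (K + 1) / (b - a))
  refine ⟨n.succPNat, round (((a + b) / 2 - o n.succPNat) * (n + 1)), fun j hj => ?_⟩
  set N := n.succPNat
  have hN : ((N : ℕ) : ℝ) = n + 1 := by simp [N]
  have hn0 : (0 : ℝ) < n + 1 := by positivity
  have hba : 0 < b - a := sub_pos.2 hab
  rw [div_lt_iff₀ hba] at hn
  have h1 := abs_le.1 (abs_sub_round (((a + b) / 2 - o N) * (n + 1)))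
  set k := round (((a + b) / 2 - o N) * (n + 1))
  have hj' : |(j : ℝ)| ≤ K := by exact_mod_cast hj
  have h2 := abs_le.1 hj'
  have h3 : gridPoint (o N) N (j + k) = o N + (j + k) / (n + 1) := by
    rw [gridPoint, hN]; push_cast; ring
  change gridPoint (o N) N (j + k) ∈ Ioo a b
  rw [h3]
  constructor
  · rw [← sub_lt_iff_lt_add', lt_div_iff₀ hn0]
    nlinarith [h1.1, h1.2, h2.1, h2.2]
  · rw [← lt_sub_iff_add_lt', div_lt_iff₀ hn0]
    nlinarith [h1.1, h1.2, h2.1, h2.2]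

open Classical in
/-- Every trigonometric polynomial, after a shift of its frequencies, is seen by `T^N` for a
suitable `N`; a stability bound for the scheme is thus one for the Laurent operator. -/
theorem norm_le_mul_norm_sub_sawtoothMul {a b : ℝ} (hab : a < b) (o : ℕ+ → ℝ) {lam : ℂ} {C : ℝ}
    (hC : ∀ N : ℕ+, IsUnit (algebraMap ℂ _ lam - schemeOperator a b (o N) N) ∧
      ‖resolvent (schemeOperator a b (o N) N) lam‖ ≤ C) (f : L2Circle) :
    ‖f‖ ≤ C * ‖lam • f - sawtoothMul f‖ := by
  have hC0 : 0 ≤ C := (norm_nonneg _).trans (hC 1).2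
  have hclosed : IsClosed {f : L2Circle | ‖f‖ ≤ C * ‖lam • f - sawtoothMul f‖} :=
    isClosed_le continuous_norm
      (continuous_const.mul ((continuous_const_smul lam).sub sawtoothMul.continuous).norm)
  have hsub : (Submodule.span ℂ (range (@fourierLp 1 _ 2 _)) : Set L2Circle) ⊆
      {f : L2Circle | ‖f‖ ≤ C * ‖lam • f - sawtoothMul f‖} := by
    intro f hf
    obtain ⟨c, rfl⟩ := (Finsupp.mem_span_range_iff_exists_finsupp).1 hf
    set f : L2Circle := c.sum fun i a => a • fourierLp 2 i with hfdef
    obtain ⟨K, hK⟩ : ∃ K : ℕ, ∀ j ∈ c.support, |j| ≤ (K : ℤ) := by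
      refine ⟨c.support.sup Int.natAbs, fun j hj => ?_⟩
      rw [Int.abs_eq_natAbs]
      exact_mod_cast Finset.le_sup (f := Int.natAbs) hj
    obtain ⟨N, k, hk⟩ := exists_forall_add_mem_gridIndex hab o K
    set u : EuclideanSpace ℂ (gridIndex a b (o N) N) := WithLp.toLp 2 fun n => c ((n : ℤ) - k)
      with hu
    have hfu : trigPoly a b (o N) N u = characterMul k f := by
      rw [hfdef, Finsupp.sum, map_sum, trigPoly]
      simp only [map_smul, characterMul_fourierLp]
      refine (Finset.sum_of_injOn
        (fun j => if h : j + k ∈ gridIndex a b (o N) N then ⟨j + k, h⟩ else ⟨k, by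
          simpa using hk 0 (by simp)⟩) ?_ ?_ ?_ ?_).symm
      · intro i hi j hj hij
        have hi' := hk i (hK i hi)
        have hj' := hk j (hK j hj)
        simp only [hi', hj', dif_pos, Subtype.mk.injEq] at hij
        linarith
      · intro i _; simp
      · intro n _ hn
        have : c ((n : ℤ) - k) = 0 := by
          by_contra h0
          refine hn ⟨(n : ℤ) - k, by simpa using h0, ?_⟩
          simp
        rw [hu]
        simp [this]
      · intro i hi
        have hi' := hk i (hK i hi)
        simp [hi', hu]
    have h1 := norm_le_norm_resolvent_mul (hC N).1 u
    have h2 : (algebraMap ℂ _ lam - schemeOperator a b (o N) N) u =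
        lam • u - schemeOperator a b (o N) N u := by
      simp [Algebra.algebraMap_eq_smul_one]
    rw [h2] at h1
    have h3 := norm_sub_schemeOperator_le lam u
    rw [hfu, norm_sub_sawtoothMul_characterMul] at h3
    rw [← norm_trigPoly u, hfu, norm_characterMul_apply] at h1
    calc ‖f‖ ≤ _ := h1
      _ ≤ C * ‖lam • f - sawtoothMul f‖ := by
        gcongr
        exact (hC N).2
  have hdense : f ∈ (Submodule.span ℂ (range (@fourierLp 1 _ 2 _))).topologicalClosure := by
    rw [span_fourierLp_closure_eq_top (by simp)]
    trivial
  exact closure_minimal hsub hclosed hdense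

theorem notMem_unitSegment_of_isStableScheme {a b : ℝ} (hab : a < b) {o : ℕ+ → ℝ} {lam : ℂ}
    (h : IsStableScheme a b o lam) : lam ∉ unitSegment := by
  obtain ⟨C, hC⟩ := h
  have hC0 : 0 ≤ C := (norm_nonneg _).trans (hC 1).2
  intro hlam
  obtain ⟨f, hf0, hf⟩ := exists_norm_sub_sawtoothMul_le hlam
    (show 0 < (2 * (C + 1))⁻¹ by positivity)
  have h1 := norm_le_mul_norm_sub_sawtoothMul hab o hC f
  have hf' : 0 < ‖f‖ := norm_pos_iff.2 hf0
  have h2 : ‖f‖ ≤ C * ((2 * (C + 1))⁻¹ * ‖f‖) := h1.trans (by gcongr)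
  have h3 : C * (2 * (C + 1))⁻¹ < 1 := by
    rw [← div_eq_mul_inv, div_lt_one (by positivity)]
    linarith
  nlinarith

theorem mem_unitSegment_of_hasEigenvalue {a b o : ℝ} {N : ℕ+} {μ : ℂ}
    (h : Module.End.HasEigenvalue (Matrix.toLin' (schemeMatrix a b o N)) μ) :
    μ ∈ unitSegment := by
  by_contra hμ
  obtain ⟨v, hv⟩ := h.exists_hasEigenvector
  have hu := isUnit_algebraMap_sub_of_notMem (isSymmetric_schemeOperator a b o N)
    norm_schemeOperator_le hμ
  have h1 := norm_le_norm_resolvent_mul hu (WithLp.toLp 2 v)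
  have h2 : (algebraMap ℂ _ μ - schemeOperator a b o N) (WithLp.toLp 2 v) = 0 := by
    have h3 : schemeOperator a b o N (WithLp.toLp 2 v) =
        WithLp.toLp 2 (Matrix.toLin' (schemeMatrix a b o N) v) := rfl
    have h4 : (algebraMap ℂ _ μ - schemeOperator a b o N) (WithLp.toLp 2 v) =
        μ • WithLp.toLp 2 v - schemeOperator a b o N (WithLp.toLp 2 v) := by
      simp [Algebra.algebraMap_eq_smul_one]
    rw [h4, h3, hv.apply_eq_smul]
    simp
  rw [h2, norm_zero, mul_zero, norm_le_zero_iff] at h1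
  exact hv.2 (by simpa using h1)

/-! ### The Poisson kernel and Lebesgue points -/

/-- The Poisson kernel of the half plane at height `ε`, up to the factor `1 / π`. -/
noncomputable def poissonLine (ε s : ℝ) : ℝ := ε / (s ^ 2 + ε ^ 2)

theorem poissonLine_nonneg {ε : ℝ} (hε : 0 < ε) (s : ℝ) : 0 ≤ poissonLine ε s := by
  unfold poissonLine; positivity

theorem measurable_poissonLine (ε : ℝ) : Measurable (poissonLine ε) := by
  unfold poissonLine; fun_prop

theorem poissonLine_eq_cauchyPDFReal {ε : ℝ} (hε : 0 < ε) (x y : ℝ) :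
    poissonLine ε (y - x) = Real.pi * ProbabilityTheory.cauchyPDFReal x ε.toNNReal y := by
  rw [ProbabilityTheory.cauchyPDFReal_def, poissonLine]
  have := Real.pi_ne_zero
  have h : (y - x) ^ 2 + ε ^ 2 ≠ 0 := by positivity
  rw [Real.coe_toNNReal _ hε.le]
  field_simp

theorem integrable_poissonLine {ε : ℝ} (hε : 0 < ε) (x : ℝ) :
    Integrable fun y => poissonLine ε (y - x) := by
  simp_rw [poissonLine_eq_cauchyPDFReal hε]
  exact (ProbabilityTheory.integrable_cauchyPDFReal x).const_mul _

theorem integral_poissonLine {ε : ℝ} (hε : 0 < ε) (x : ℝ) :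
    ∫ y, poissonLine ε (y - x) = Real.pi := by
  simp_rw [poissonLine_eq_cauchyPDFReal hε]
  rw [integral_const_mul, ProbabilityTheory.integral_cauchyPDFReal_eq_one x
    (Real.toNNReal_pos.2 hε).ne', mul_one]

theorem lintegral_poissonLine {ε : ℝ} (hε : 0 < ε) :
    ∫⁻ y, ENNReal.ofReal (poissonLine ε y) = ENNReal.ofReal Real.pi := by
  have h := integrable_poissonLine hε 0
  have h2 := integral_poissonLine hε 0
  simp only [sub_zero] at h h2
  rw [← ofReal_integral_eq_lintegral_ofReal h (.of_forall (poissonLine_nonneg hε)), h2]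

/-- The Poisson kernel is a superposition of indicators of symmetric intervals. -/
theorem ofReal_poissonLine_eq_lintegral {ε : ℝ} (hε : 0 < ε) {s : ℝ} (hs : 0 ≤ s) :
    ENNReal.ofReal (poissonLine ε s) =
      ∫⁻ r in Ioi s, ENNReal.ofReal (2 * ε * r / (r ^ 2 + ε ^ 2) ^ 2) := by
  have hderiv : ∀ r ∈ Ici s, HasDerivAt (fun r => -poissonLine ε r)
      (2 * ε * r / (r ^ 2 + ε ^ 2) ^ 2) r := by
    intro r _
    have h0 : r ^ 2 + ε ^ 2 ≠ 0 := by positivity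
    have h := ((hasDerivAt_const r ε).div (((hasDerivAt_id r).pow 2).add_const (ε ^ 2)) h0).neg
    refine h.congr_deriv ?_
    simp
    ring
  have hpos : ∀ r ∈ Ioi s, 0 ≤ 2 * ε * r / (r ^ 2 + ε ^ 2) ^ 2 := by
    intro r hr
    have : 0 < r := hs.trans_lt hr
    positivity
  have hlim : Tendsto (fun r => -poissonLine ε r) atTop (𝓝 0) := by
    rw [← neg_zero]
    refine Tendsto.neg (tendsto_const_nhds.div_atTop ?_)
    exact tendsto_atTop_add_const_right _ _ (tendsto_pow_atTop two_ne_zero)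
  have hint := integrableOn_Ioi_deriv_of_nonneg' hderiv hpos hlim
  have h := integral_Ioi_of_hasDerivAt_of_nonneg' hderiv hpos hlim
  rw [← ofReal_integral_eq_lintegral_ofReal hint ((ae_restrict_iff' measurableSet_Ioi).2
    (.of_forall hpos)), h]
  simp

theorem lintegral_mul_poissonLine_eq {φ : ℝ → ENNReal} (hφ : AEMeasurable φ) (x : ℝ) {ε : ℝ}
    (hε : 0 < ε) :
    ∫⁻ y, φ y * ENNReal.ofReal (poissonLine ε (y - x)) =
      ∫⁻ r in Ioi 0, ENNReal.ofReal (2 * ε * r / (r ^ 2 + ε ^ 2) ^ 2) *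
        ∫⁻ y in Metric.ball x r, φ y := by
  set k : ℝ → ENNReal := fun r => ENNReal.ofReal (2 * ε * r / (r ^ 2 + ε ^ 2) ^ 2) with hk
  have hkm : Measurable k := by rw [hk]; fun_prop
  have hset : MeasurableSet {p : ℝ × ℝ | |p.1 - x| < p.2} :=
    measurableSet_lt (by fun_prop) (by fun_prop)
  have h1 : ∀ y, φ y * ENNReal.ofReal (poissonLine ε (y - x)) =
      ∫⁻ r, φ y * {p : ℝ × ℝ | |p.1 - x| < p.2}.indicator (fun p => k p.2) (y, r) := by
    intro y
    have : poissonLine ε (y - x) = poissonLine ε |y - x| := by simp [poissonLine]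
    rw [this, ofReal_poissonLine_eq_lintegral hε (abs_nonneg _), lintegral_const_mul,
      ← lintegral_indicator measurableSet_Ioi]
    · rfl
    · exact (hkm.comp measurable_snd).indicator hset |>.comp measurable_prodMk_left
  have h2 : ∀ r, (Ioi (0 : ℝ)).indicator (fun r => k r * ∫⁻ y in Metric.ball x r, φ y) r =
      ∫⁻ y, φ y * {p : ℝ × ℝ | |p.1 - x| < p.2}.indicator (fun p => k p.2) (y, r) := by
    intro r
    by_cases hr : r ∈ Ioi (0 : ℝ)
    · rw [indicator_of_mem hr, ← lintegral_const_mul'' _ hφ.restrict,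
        ← lintegral_indicator Metric.isOpen_ball.measurableSet]
      refine lintegral_congr fun y => ?_
      by_cases hy : |y - x| < r
      · rw [indicator_of_mem (by simpa [Real.dist_eq] using hy), indicator_of_mem (by exact hy),
          mul_comm]
      · rw [indicator_of_notMem (by simpa [Real.dist_eq] using hy),
          indicator_of_notMem (by exact hy), mul_zero]
    · rw [indicator_of_notMem hr]
      have : ∀ y, φ y * {p : ℝ × ℝ | |p.1 - x| < p.2}.indicator (fun p => k p.2) (y, r) = 0 := by
        intro y
        rw [indicator_of_notMem, mul_zero]
        exact fun h => hr (lt_of_le_of_lt (abs_nonneg (y - x)) h : (0 : ℝ) < r)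
      simp [this]
  simp_rw [h1]
  rw [lintegral_lintegral_swap, ← lintegral_indicator measurableSet_Ioi]
  · exact (lintegral_congr h2).symm
  · exact (hφ.comp_fst).mul ((hkm.comp measurable_snd).indicator hset).aemeasurable

/-- If the means of `φ` over the balls around `x` are at most `η` for small radii and at most `B`
for all radii, the Poisson mean is at most about `η` for small `ε`. -/
theorem lintegral_mul_poissonLine_le {φ : ℝ → ENNReal} (hφ : AEMeasurable φ) (x : ℝ)
    {η B : ENNReal} {δ ε : ℝ} (hδ : 0 < δ) (hε : 0 < ε)
    (hη : ∀ r, 0 < r → r < δ → ∫⁻ y in Metric.ball x r, φ y ≤ ENNReal.ofReal (2 * r) * η)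
    (hB : ∀ r, 0 < r → ∫⁻ y in Metric.ball x r, φ y ≤ ENNReal.ofReal (2 * r) * B) :
    ∫⁻ y, φ y * ENNReal.ofReal (poissonLine ε (y - x)) ≤
      η * ENNReal.ofReal (4 * Real.pi) + B * ENNReal.ofReal (8 * Real.pi / δ * ε) := by
  rw [lintegral_mul_poissonLine_eq hφ x hε]
  have hpt : ∀ r ∈ Ioi (0 : ℝ), ENNReal.ofReal (2 * ε * r / (r ^ 2 + ε ^ 2) ^ 2) *
      ∫⁻ y in Metric.ball x r, φ y ≤
        η * (ENNReal.ofReal 4 * ENNReal.ofReal (poissonLine ε r)) +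
          B * (ENNReal.ofReal (8 / δ * ε) * ENNReal.ofReal (poissonLine δ r)) := by
    intro r hr
    have hr0 : 0 < r := hr
    have hk0 : 0 ≤ 2 * ε * r / (r ^ 2 + ε ^ 2) ^ 2 := by positivity
    have hke : 2 * ε * r / (r ^ 2 + ε ^ 2) ^ 2 * (2 * r) ≤ 4 * poissonLine ε r := by
      rw [poissonLine, div_mul_eq_mul_div, mul_div_assoc', div_le_div_iff₀ (by positivity)
        (by positivity)]
      have : 0 ≤ 4 * ε * (r ^ 2 + ε ^ 2) * ε ^ 2 := by positivity
      nlinarith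
    rcases lt_or_ge r δ with h | h
    · refine le_add_right ?_
      calc _ ≤ ENNReal.ofReal (2 * ε * r / (r ^ 2 + ε ^ 2) ^ 2) *
            (ENNReal.ofReal (2 * r) * η) := by gcongr; exact hη r hr0 h
        _ = η * ENNReal.ofReal (2 * ε * r / (r ^ 2 + ε ^ 2) ^ 2 * (2 * r)) := by
          rw [ENNReal.ofReal_mul hk0, ← mul_assoc, mul_comm]
        _ ≤ _ := by
          rw [← ENNReal.ofReal_mul (by norm_num)]
          gcongr
    · refine le_add_left ?_
      calc _ ≤ ENNReal.ofReal (2 * ε * r / (r ^ 2 + ε ^ 2) ^ 2) *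
            (ENNReal.ofReal (2 * r) * B) := by gcongr; exact hB r hr0
        _ = B * ENNReal.ofReal (2 * ε * r / (r ^ 2 + ε ^ 2) ^ 2 * (2 * r)) := by
          rw [ENNReal.ofReal_mul hk0, ← mul_assoc, mul_comm]
        _ ≤ _ := by
          rw [← ENNReal.ofReal_mul (by positivity)]
          refine mul_le_mul' le_rfl (ENNReal.ofReal_le_ofReal (hke.trans ?_))
          have h8 : 8 / δ * ε * poissonLine δ r = 8 * ε / (r ^ 2 + δ ^ 2) := by
            rw [poissonLine]; field_simp
          rw [h8, poissonLine, mul_div_assoc', div_le_div_iff₀ (by positivity) (by positivity)]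
          have h9 : δ ^ 2 ≤ r ^ 2 := by gcongr
          nlinarith [mul_nonneg hε.le (sub_nonneg.2 h9), pow_pos hε 3]
  have hm : ∀ ε : ℝ, Measurable fun r => ENNReal.ofReal (poissonLine ε r) := fun ε =>
    (measurable_poissonLine ε).ennreal_ofReal
  have hle : ∀ ε : ℝ, 0 < ε → ∫⁻ r in Ioi 0, ENNReal.ofReal (poissonLine ε r) ≤
      ENNReal.ofReal Real.pi := fun ε hε =>
    (setLIntegral_le_lintegral _ _).trans (lintegral_poissonLine hε).le
  calc _ ≤ ∫⁻ r in Ioi 0, (η * (ENNReal.ofReal 4 * ENNReal.ofReal (poissonLine ε r)) +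
          B * (ENNReal.ofReal (8 / δ * ε) * ENNReal.ofReal (poissonLine δ r))) :=
        setLIntegral_mono' measurableSet_Ioi hpt
    _ = η * (ENNReal.ofReal 4 * ∫⁻ r in Ioi 0, ENNReal.ofReal (poissonLine ε r)) +
        B * (ENNReal.ofReal (8 / δ * ε) * ∫⁻ r in Ioi 0, ENNReal.ofReal (poissonLine δ r)) := by
      rw [lintegral_add_left (((hm ε).const_mul _).const_mul _),
        lintegral_const_mul _ ((hm ε).const_mul _), lintegral_const_mul _ (hm ε),
        lintegral_const_mul _ ((hm δ).const_mul _), lintegral_const_mul _ (hm δ)]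
    _ ≤ η * (ENNReal.ofReal 4 * ENNReal.ofReal Real.pi) +
        B * (ENNReal.ofReal (8 / δ * ε) * ENNReal.ofReal Real.pi) := by
      gcongr
      · exact hle ε hε
      · exact hle δ hδ
    _ = _ := by
      rw [← ENNReal.ofReal_mul (by norm_num), ← ENNReal.ofReal_mul (by positivity)]
      congr 3
      ring

/-- Square integrable functions converge to their values in the Poisson mean at almost every
point. -/
theorem ae_tendsto_lintegral_enorm_sub_mul_poissonLine {f : ℝ → ℂ} (hf : MemLp f 2) :
    ∀ᵐ x, Tendsto (fun ε => ∫⁻ y, ‖f y - f x‖ₑ * ENNReal.ofReal (poissonLine ε (y - x)))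
      (𝓝[>] 0) (𝓝 0) := by
  have hloc : LocallyIntegrable f := hf.locallyIntegrable (by norm_num)
  have hfin : ∫⁻ y, ‖f y‖ₑ ^ 2 < ⊤ := by
    have := (eLpNorm_lt_top_iff_lintegral_rpow_enorm_lt_top two_ne_zero ENNReal.ofNat_ne_top).1
      hf.2
    simpa using this
  filter_upwards [(Besicovitch.vitaliFamily (volume : Measure ℝ)).ae_tendsto_lintegral_enorm_sub_div
    hloc] with x hx
  have hx' := hx.comp (Besicovitch.tendsto_filterAt volume x)
  have hφ : AEMeasurable fun y => ‖f y - f x‖ₑ := (hf.1.sub aestronglyMeasurable_const).enorm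
  have hsmall : ∀ η : ENNReal, 0 < η → ∃ δ > 0, ∀ r, 0 < r → r < δ →
      ∫⁻ y in Metric.ball x r, ‖f y - f x‖ₑ ≤ ENNReal.ofReal (2 * r) * η := by
    intro η hη
    have h := (ENNReal.tendsto_nhds_zero.1 hx') η hη
    rw [eventually_nhdsWithin_iff] at h
    obtain ⟨δ, hδ, h⟩ := Metric.eventually_nhds_iff.1 h
    refine ⟨δ, hδ, fun r hr0 hr => ?_⟩
    have h1 := h (y := r) (by simpa [abs_of_pos hr0] using hr) hr0
    simp only [Function.comp, Real.volume_closedBall] at h1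
    have hv : ENNReal.ofReal (2 * r) ≠ 0 := by simpa using hr0
    rw [ENNReal.div_le_iff hv ENNReal.ofReal_ne_top, mul_comm] at h1
    exact (lintegral_mono_set Metric.ball_subset_closedBall).trans h1
  -- Over small balls the Lebesgue point property bounds the means, over large ones the `L²` norm.
  obtain ⟨δ₀, hδ₀, h₀⟩ := hsmall 1 one_pos
  set B : ENNReal := 1 + ((1 + ‖f x‖ₑ) + (∫⁻ y, ‖f y‖ₑ ^ 2) / ENNReal.ofReal (2 * δ₀)) with hBdef
  have hδ₀' : ENNReal.ofReal (2 * δ₀) ≠ 0 := by simpa using hδ₀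
  have hBtop : B ≠ ⊤ := by
    rw [hBdef]
    simp only [ne_eq, ENNReal.add_eq_top, not_or]
    exact ⟨by simp, ⟨by simp, by simp⟩, (ENNReal.div_lt_top hfin.ne hδ₀').ne⟩
  have hB : ∀ r, 0 < r →
      ∫⁻ y in Metric.ball x r, ‖f y - f x‖ₑ ≤ ENNReal.ofReal (2 * r) * B := by
    intro r hr0
    rcases lt_or_ge r δ₀ with hr | hr
    · exact (h₀ r hr0 hr).trans (by gcongr; exact le_self_add)
    · have hpt : ∀ y, ‖f y - f x‖ₑ ≤ (1 + ‖f x‖ₑ) + ‖f y‖ₑ ^ 2 := by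
        intro y
        have h1 : ‖f y‖ₑ ≤ 1 + ‖f y‖ₑ ^ 2 := by
          rcases le_total ‖f y‖ₑ 1 with h | h
          · exact le_add_right h
          · refine le_add_left ?_
            rw [sq]
            exact le_mul_of_one_le_left' h
        calc ‖f y - f x‖ₑ ≤ ‖f y‖ₑ + ‖f x‖ₑ := enorm_sub_le
          _ ≤ (1 + ‖f y‖ₑ ^ 2) + ‖f x‖ₑ := by gcongr
          _ = _ := by ring
      calc ∫⁻ y in Metric.ball x r, ‖f y - f x‖ₑ
          ≤ ∫⁻ y in Metric.ball x r, ((1 + ‖f x‖ₑ) + ‖f y‖ₑ ^ 2) := lintegral_mono hpt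
        _ = ENNReal.ofReal (2 * r) * (1 + ‖f x‖ₑ) + ∫⁻ y in Metric.ball x r, ‖f y‖ₑ ^ 2 := by
          rw [lintegral_add_left measurable_const, setLIntegral_const, Real.volume_ball, mul_comm]
        _ ≤ ENNReal.ofReal (2 * r) * (1 + ‖f x‖ₑ) +
            ENNReal.ofReal (2 * r) * ((∫⁻ y, ‖f y‖ₑ ^ 2) / ENNReal.ofReal (2 * δ₀)) := by
          gcongr
          calc ∫⁻ y in Metric.ball x r, ‖f y‖ₑ ^ 2 ≤ ∫⁻ y, ‖f y‖ₑ ^ 2 :=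
                setLIntegral_le_lintegral _ _
            _ = ENNReal.ofReal (2 * δ₀) * ((∫⁻ y, ‖f y‖ₑ ^ 2) / ENNReal.ofReal (2 * δ₀)) :=
              (ENNReal.mul_div_cancel hδ₀' ENNReal.ofReal_ne_top).symm
            _ ≤ _ := by gcongr
        _ = ENNReal.ofReal (2 * r) *
            ((1 + ‖f x‖ₑ) + (∫⁻ y, ‖f y‖ₑ ^ 2) / ENNReal.ofReal (2 * δ₀)) :=
          (mul_add _ _ _).symm
        _ ≤ _ := by gcongr; exact le_add_self
  refine ENNReal.tendsto_nhds_zero.2 fun c hc => ?_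
  have hpi : ENNReal.ofReal (4 * Real.pi) ≠ 0 := by simpa using Real.pi_pos
  obtain ⟨δ, hδ, hη⟩ := hsmall (c / 2 / ENNReal.ofReal (4 * Real.pi))
    (ENNReal.div_pos (ENNReal.div_pos hc.ne' ENNReal.ofNat_ne_top).ne' ENNReal.ofReal_ne_top)
  have hlim : Tendsto (fun ε : ℝ => B * ENNReal.ofReal (8 * Real.pi / δ * ε)) (𝓝[>] 0) (𝓝 0) := by
    have h1 : Tendsto (fun ε : ℝ => ENNReal.ofReal (8 * Real.pi / δ * ε)) (𝓝[>] 0) (𝓝 0) := by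
      have h2 : Continuous fun ε : ℝ => ENNReal.ofReal (8 * Real.pi / δ * ε) :=
        ENNReal.continuous_ofReal.comp (continuous_const.mul continuous_id)
      simpa using (h2.tendsto 0).mono_left nhdsWithin_le_nhds
    simpa using ENNReal.Tendsto.const_mul h1 (Or.inr hBtop)
  filter_upwards [self_mem_nhdsWithin, ENNReal.tendsto_nhds_zero.1 hlim (c / 2)
    (ENNReal.div_pos hc.ne' ENNReal.ofNat_ne_top)] with ε hε h2
  refine (lintegral_mul_poissonLine_le hφ x hδ hε hη hB).trans ?_
  calc _ ≤ c / 2 + c / 2 := by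
        gcongr
        rw [ENNReal.div_mul_cancel hpi ENNReal.ofReal_ne_top]
    _ = c := ENNReal.add_halves c

/-! ### Cauchy kernels -/

/-- The Cauchy kernel `y ↦ 1 / (y - w)` on the real line. -/
noncomputable def cauchyKernel (w : ℂ) (y : ℝ) : ℂ := ((y : ℂ) - w)⁻¹

theorem ofReal_sub_ne_zero {w : ℂ} (hw : w.im ≠ 0) (y : ℝ) : (y : ℂ) - w ≠ 0 := by
  intro h
  have := congrArg Complex.im h
  simp at this
  exact hw this

theorem continuous_cauchyKernel {w : ℂ} (hw : w.im ≠ 0) : Continuous (cauchyKernel w) :=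
  (Complex.continuous_ofReal.sub continuous_const).inv₀ (ofReal_sub_ne_zero hw)

theorem norm_sq_ofReal_sub (w : ℂ) (y : ℝ) :
    ‖(y : ℂ) - w‖ ^ 2 = (y - w.re) ^ 2 + w.im ^ 2 := by
  rw [Complex.sq_norm, Complex.normSq_apply]
  simp
  ring

theorem memLp_cauchyKernel {w : ℂ} (hw : w.im ≠ 0) : MemLp (cauchyKernel w) 2 := by
  rw [memLp_two_iff_integrable_sq_norm (continuous_cauchyKernel hw).aestronglyMeasurable]
  refine ((integrable_poissonLine (abs_pos.2 hw) w.re).const_mul |w.im|⁻¹).congr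
    (.of_forall fun y => ?_)
  have := abs_pos.2 hw
  simp only [cauchyKernel, norm_inv, inv_pow, norm_sq_ofReal_sub, poissonLine, sq_abs]
  field_simp

theorem integrable_mul_cauchyKernel {f : ℝ → ℂ} (hf : MemLp f 2) {w : ℂ} (hw : w.im ≠ 0) :
    Integrable fun y => f y * cauchyKernel w y :=
  hf.integrable_mul (memLp_cauchyKernel hw)

theorem tendsto_cauchyKernel (w : ℂ) {l : Filter ℝ} (hl : Tendsto (fun y : ℝ => |y|) l atTop) :
    Tendsto (cauchyKernel w) l (𝓝 0) := by
  rw [tendsto_zero_iff_norm_tendsto_zero]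
  simp only [cauchyKernel, norm_inv]
  refine Tendsto.inv_tendsto_atTop (tendsto_atTop_mono (fun y => ?_)
    (tendsto_atTop_add_const_right _ (-‖w‖) hl))
  have := norm_sub_norm_le (y : ℂ) w
  rw [Complex.norm_real, Real.norm_eq_abs] at this
  linarith

/-- Two Cauchy kernels with poles in the lower half plane have a product of integral zero: the
product has the antiderivative `log ((y - α) / (y - β)) / (α - β)`, which vanishes at infinity. -/
theorem integral_cauchyKernel_mul_cauchyKernel {α β : ℂ} (hα : α.im < 0) (hβ : β.im < 0) :
    ∫ y, cauchyKernel α y * cauchyKernel β y = 0 := by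
  have hint : Integrable fun y => cauchyKernel α y * cauchyKernel β y :=
    integrable_mul_cauchyKernel (memLp_cauchyKernel hα.ne) hβ.ne
  have hα0 := ofReal_sub_ne_zero hα.ne
  have hβ0 := ofReal_sub_ne_zero hβ.ne
  have hd : ∀ (w : ℂ) (y : ℝ), HasDerivAt (fun y : ℝ => (y : ℂ) - w) 1 y := fun w y =>
    (Complex.ofRealCLM.hasDerivAt (x := y)).sub_const w
  rcases eq_or_ne α β with rfl | hne
  · have h : ∀ y, HasDerivAt (fun y => -cauchyKernel α y) (cauchyKernel α y * cauchyKernel α y)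
        y := by
      intro y
      refine ((hd α y).inv (hα0 y)).neg.congr_deriv ?_
      simp only [cauchyKernel]
      have := hα0 y
      field_simp
    have hlim : ∀ {l : Filter ℝ}, Tendsto (fun y : ℝ => |y|) l atTop →
        Tendsto (fun y => -cauchyKernel α y) l (𝓝 0) := fun hl => by
      simpa using (tendsto_cauchyKernel α hl).neg
    rw [integral_of_hasDerivAt_of_tendsto h hint (hlim tendsto_abs_atBot_atTop)
      (hlim tendsto_abs_atTop_atTop), sub_zero]
  · have hsub : α - β ≠ 0 := sub_ne_zero.2 hne
    set q : ℝ → ℂ := fun y => ((y : ℂ) - α) / ((y : ℂ) - β) with hq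
    have hslit : ∀ y, q y ∈ Complex.slitPlane := by
      intro y
      rw [Complex.mem_slitPlane_iff]
      by_contra! hcon
      have h1 : (y : ℂ) - α = q y * ((y : ℂ) - β) := by
        rw [hq]; field_simp [hβ0 y]
      have h2 := congrArg Complex.im h1
      simp [hcon.2] at h2
      nlinarith [hcon.1]
    have h : ∀ y, HasDerivAt (fun y => (α - β)⁻¹ * Complex.log (q y))
        (cauchyKernel α y * cauchyKernel β y) y := by
      intro y
      have h1 := (((hd α y).div (hd β y) (hβ0 y)).clog_real (hslit y)).const_mul (α - β)⁻¹
      refine h1.congr_deriv ?_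
      have := hα0 y
      have := hβ0 y
      simp only [cauchyKernel, Pi.div_apply]
      field_simp
      ring
    have hlim : ∀ {l : Filter ℝ}, Tendsto (fun y : ℝ => |y|) l atTop →
        Tendsto (fun y => (α - β)⁻¹ * Complex.log (q y)) l (𝓝 0) := fun {l} hl => by
      have h1 : Tendsto q l (𝓝 1) := by
        have h2 := ((tendsto_cauchyKernel β hl).const_mul (β - α)).const_add 1
        rw [mul_zero, add_zero] at h2
        refine h2.congr fun y => ?_
        have := hβ0 y
        simp only [hq, cauchyKernel]
        field_simp
        ring
      have h3 := ((continuousAt_clog Complex.one_mem_slitPlane).tendsto.comp h1).const_mul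
        (α - β)⁻¹
      simpa using h3
    rw [integral_of_hasDerivAt_of_tendsto h hint (hlim tendsto_abs_atBot_atTop)
      (hlim tendsto_abs_atTop_atTop), sub_zero]

/-! ### The Cauchy transformation and its boundary values -/

/-- The Cauchy integral `∫ f(y) / (y - z) dy`. -/
noncomputable def cauchyTransform (f : ℝ → ℂ) (z : ℂ) : ℂ := ∫ y, f y * cauchyKernel z y

theorem cauchyKernel_sub_conj {ε : ℝ} (hε : 0 < ε) (x y : ℝ) :
    cauchyKernel ⟨x, ε⟩ y - cauchyKernel ⟨x, -ε⟩ y = 2 * Complex.I * poissonLine ε (y - x) := by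
  have h1 : (y : ℂ) - ⟨x, ε⟩ ≠ 0 := ofReal_sub_ne_zero (by simpa using hε.ne') y
  have h2 : (y : ℂ) - ⟨x, -ε⟩ ≠ 0 := ofReal_sub_ne_zero (by simpa using hε.ne') y
  have h3 : (((y - x) ^ 2 + ε ^ 2 : ℝ) : ℂ) ≠ 0 := by
    norm_cast; positivity
  have h4 : ((y : ℂ) - ⟨x, ε⟩) * ((y : ℂ) - ⟨x, -ε⟩) = (((y - x) ^ 2 + ε ^ 2 : ℝ) : ℂ) := by
    apply Complex.ext <;> simp [-Complex.ofReal_add, -Complex.ofReal_pow] <;> ring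
  have h5 : ((y : ℂ) - ⟨x, -ε⟩) - ((y : ℂ) - ⟨x, ε⟩) = 2 * Complex.I * ε := by
    apply Complex.ext <;> simp; ring
  simp only [cauchyKernel]
  rw [inv_sub_inv h1 h2, h4, h5, poissonLine, Complex.ofReal_div, mul_div_assoc]

theorem cauchyKernel_add_conj {ε : ℝ} (hε : 0 < ε) (x y : ℝ) :
    cauchyKernel ⟨x, ε⟩ y + cauchyKernel ⟨x, -ε⟩ y =
      2 * (((y - x) / ((y - x) ^ 2 + ε ^ 2) : ℝ) : ℂ) := by
  have h1 : (y : ℂ) - ⟨x, ε⟩ ≠ 0 := ofReal_sub_ne_zero (by simpa using hε.ne') y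
  have h2 : (y : ℂ) - ⟨x, -ε⟩ ≠ 0 := ofReal_sub_ne_zero (by simpa using hε.ne') y
  have h4 : ((y : ℂ) - ⟨x, ε⟩) * ((y : ℂ) - ⟨x, -ε⟩) = (((y - x) ^ 2 + ε ^ 2 : ℝ) : ℂ) := by
    apply Complex.ext <;> simp [-Complex.ofReal_add, -Complex.ofReal_pow] <;> ring
  have h5 : ((y : ℂ) - ⟨x, ε⟩) + ((y : ℂ) - ⟨x, -ε⟩) = 2 * ((y - x : ℝ) : ℂ) := by
    apply Complex.ext <;> simp; ring
  simp only [cauchyKernel]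
  rw [inv_add_inv h1 h2, h4, h5, Complex.ofReal_div, mul_div_assoc]

/-- `x` is a Lebesgue point of `f` with respect to the Poisson means. -/
def IsPoissonPoint (f : ℝ → ℂ) (x : ℝ) : Prop :=
  Tendsto (fun ε => ∫⁻ y, ‖f y - f x‖ₑ * ENNReal.ofReal (poissonLine ε (y - x))) (𝓝[>] 0) (𝓝 0)

/-- Kernels dominated by the Poisson kernel annihilate `f - f x` in the limit. -/
theorem IsPoissonPoint.tendsto_integral {f : ℝ → ℂ} {x : ℝ} (hx : IsPoissonPoint f x)
    {k : ℝ → ℝ → ℂ} (hk : ∀ ε > 0, ∀ y, ‖k ε y‖ ≤ poissonLine ε (y - x)) :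
    Tendsto (fun ε => ∫ y, (f y - f x) * k ε y) (𝓝[>] 0) (𝓝 0) := by
  rw [tendsto_zero_iff_enorm_tendsto_zero]
  refine tendsto_of_tendsto_of_tendsto_of_le_of_le' tendsto_const_nhds hx
    (.of_forall fun _ => zero_le) ?_
  filter_upwards [self_mem_nhdsWithin] with ε hε
  refine (enorm_integral_le_lintegral_enorm _).trans (lintegral_mono fun y => ?_)
  rw [enorm_mul]
  gcongr
  rw [← ofReal_norm]
  exact ENNReal.ofReal_le_ofReal (hk ε hε y)

/-- Jump relation of the Cauchy integral. -/
theorem IsPoissonPoint.tendsto_cauchyTransform_sub {f : ℝ → ℂ} (hf : MemLp f 2) {x : ℝ}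
    (hx : IsPoissonPoint f x) :
    Tendsto (fun ε => cauchyTransform f ⟨x, ε⟩ - cauchyTransform f ⟨x, -ε⟩) (𝓝[>] 0)
      (𝓝 (2 * Real.pi * Complex.I * f x)) := by
  have h := (hx.tendsto_integral (k := fun ε y => (poissonLine ε (y - x) : ℂ))
    (fun ε hε y => by
      rw [Complex.norm_real, Real.norm_of_nonneg (poissonLine_nonneg hε _)])).const_mul
    (2 * Complex.I) |>.add_const (2 * Real.pi * Complex.I * f x)
  rw [mul_zero, zero_add] at h
  refine h.congr' ?_
  filter_upwards [self_mem_nhdsWithin] with ε hε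
  have hε' : 0 < ε := hε
  have i1 := integrable_mul_cauchyKernel hf (w := ⟨x, ε⟩) hε'.ne'
  have i2 := integrable_mul_cauchyKernel hf (w := ⟨x, -ε⟩) (neg_ne_zero.2 hε'.ne')
  have hp : Integrable fun y => (poissonLine ε (y - x) : ℂ) := (integrable_poissonLine hε' x).ofReal
  have hfp : (fun y => f y * (poissonLine ε (y - x) : ℂ)) = fun y => (2 * Complex.I)⁻¹ *
      (f y * cauchyKernel ⟨x, ε⟩ y - f y * cauchyKernel ⟨x, -ε⟩ y) := by
    ext y
    rw [← mul_sub, cauchyKernel_sub_conj hε']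
    field_simp
  have i3 : Integrable fun y => f y * (poissonLine ε (y - x) : ℂ) := by
    rw [hfp]; exact (i1.sub i2).const_mul _
  simp_rw [sub_mul]
  rw [integral_sub i3 (hp.const_mul _), integral_const_mul, integral_complex_ofReal,
    integral_poissonLine hε', hfp, integral_const_mul, integral_sub i1 i2, cauchyTransform,
    cauchyTransform]
  field_simp
  ring

/-- The truncated Hilbert integral and the conjugate Poisson integral have the same limit. -/
theorem IsPoissonPoint.tendsto_truncated_add {f : ℝ → ℂ} (hf : MemLp f 2) {x : ℝ}
    (hx : IsPoissonPoint f x) :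
    Tendsto (fun ε => (∫ y in {y : ℝ | ε < |x - y|}, f y / ((x : ℂ) - (y : ℂ))) +
      (cauchyTransform f ⟨x, ε⟩ + cauchyTransform f ⟨x, -ε⟩) / 2) (𝓝[>] 0) (𝓝 0) := by
  set d : ℝ → ℝ → ℝ := fun ε s => s / (s ^ 2 + ε ^ 2) - {s : ℝ | ε < |s|}.indicator (·⁻¹) s with hd
  have hbound : ∀ ε > 0, ∀ s, |d ε s| ≤ poissonLine ε s := by
    intro ε hε s
    simp only [hd, poissonLine]
    by_cases hs : ε < |s|
    · have hs0 : s ≠ 0 := abs_pos.1 (hε.trans hs)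
      rw [indicator_of_mem (by exact hs)]
      have h1 : s / (s ^ 2 + ε ^ 2) - s⁻¹ = -(ε ^ 2) / (s * (s ^ 2 + ε ^ 2)) := by
        field_simp
        ring
      rw [h1, abs_div, abs_neg, abs_mul, abs_of_pos (show 0 < s ^ 2 + ε ^ 2 by positivity),
        abs_of_pos (show 0 < ε ^ 2 by positivity), div_le_div_iff₀ (by positivity) (by positivity)]
      have h2 : 0 < ε * (s ^ 2 + ε ^ 2) := by positivity
      nlinarith
    · rw [indicator_of_notMem (by exact hs), sub_zero, abs_div,
        abs_of_pos (show 0 < s ^ 2 + ε ^ 2 by positivity)]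
      gcongr
      exact not_lt.1 hs
  have hmeas : ∀ ε, Measurable (d ε) := fun ε =>
    (by fun_prop : Measurable fun s : ℝ => s / (s ^ 2 + ε ^ 2)).sub
      (measurable_inv.indicator (measurableSet_lt measurable_const measurable_id.abs))
  have hodd : ∀ ε s, d ε (-s) = -d ε s := by
    intro ε s
    simp only [hd]
    by_cases hs : ε < |s|
    · rw [indicator_of_mem (by simpa using hs), indicator_of_mem (by exact hs)]
      rw [neg_sq, inv_neg, neg_div]; ring
    · rw [indicator_of_notMem (by simpa using hs), indicator_of_notMem (by exact hs)]
      rw [neg_sq, neg_div]; ring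
  have hzero : ∀ ε, ∫ y, d ε (y - x) = 0 := by
    intro ε
    rw [integral_sub_right_eq_self (d ε) x]
    have h1 := integral_neg_eq_self (d ε) volume
    simp_rw [hodd, integral_neg] at h1
    linarith
  have h := hx.tendsto_integral (k := fun ε y => (d ε (y - x) : ℂ))
    (fun ε hε y => by rw [Complex.norm_real]; exact hbound ε hε _)
  refine h.congr' ?_
  filter_upwards [self_mem_nhdsWithin] with ε hε
  have hε' : 0 < ε := hε
  have i1 := integrable_mul_cauchyKernel hf (w := ⟨x, ε⟩) hε'.ne'
  have i2 := integrable_mul_cauchyKernel hf (w := ⟨x, -ε⟩) (neg_ne_zero.2 hε'.ne')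
  have hdi : Integrable fun y => (d ε (y - x) : ℂ) :=
    ((integrable_poissonLine hε' x).mono'
      ((hmeas ε).comp (measurable_id.sub_const x)).aestronglyMeasurable
      (.of_forall fun y => hbound ε hε' _)).ofReal
  have hset : MeasurableSet {y : ℝ | ε < |x - y|} := measurableSet_lt (by fun_prop) (by fun_prop)
  have hpl2 : MemLp (fun y => (poissonLine ε (y - x) : ℂ)) 2 := by
    have h1 := ((memLp_cauchyKernel (w := ⟨x, ε⟩) hε'.ne').sub
      (memLp_cauchyKernel (w := ⟨x, -ε⟩) (neg_ne_zero.2 hε'.ne'))).const_mul (2 * Complex.I)⁻¹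
    refine h1.ae_eq (.of_forall fun y => ?_)
    simp only [Pi.sub_apply]
    rw [cauchyKernel_sub_conj hε']
    field_simp
  have hdl2 : MemLp (fun y => (d ε (y - x) : ℂ)) 2 := by
    refine hpl2.mono ((Complex.measurable_ofReal.comp
      ((hmeas ε).comp (measurable_id.sub_const x)))).aestronglyMeasurable (.of_forall fun y => ?_)
    rw [Complex.norm_real, Complex.norm_real, Real.norm_of_nonneg (poissonLine_nonneg hε' _)]
    exact hbound ε hε' _
  have i3 : Integrable fun y => f y * (d ε (y - x) : ℂ) := hf.integrable_mul hdl2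
  have i4 : Integrable fun y =>
      (f y * cauchyKernel ⟨x, ε⟩ y + f y * cauchyKernel ⟨x, -ε⟩ y) / 2 := (i1.add i2).div_const 2
  have hpt : ∀ y, {y : ℝ | ε < |x - y|}.indicator (fun y => f y / ((x : ℂ) - (y : ℂ))) y =
      f y * (d ε (y - x) : ℂ) -
        (f y * cauchyKernel ⟨x, ε⟩ y + f y * cauchyKernel ⟨x, -ε⟩ y) / 2 := by
    intro y
    rw [← mul_add, cauchyKernel_add_conj hε']
    simp only [hd]
    by_cases hy : ε < |y - x|
    · rw [indicator_of_mem (by rw [mem_ofPred_eq, abs_sub_comm]; exact hy),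
        indicator_of_mem (by exact hy)]
      rw [← neg_sub (y : ℂ) x, div_neg]
      push_cast
      ring
    · rw [indicator_of_notMem (by rw [mem_ofPred_eq, abs_sub_comm]; exact hy),
        indicator_of_notMem (by exact hy)]
      push_cast
      ring
  rw [← integral_indicator hset]
  simp_rw [hpt, sub_mul]
  rw [integral_sub i3 (hdi.const_mul _), integral_const_mul, integral_complex_ofReal, hzero,
    integral_sub i3 i4, integral_div, integral_add i1 i2, cauchyTransform,
    cauchyTransform]
  simp

/-! ### The Hilbert transformation on the line as a reflection -/

local notation "L2Line" => Lp ℂ 2 (volume : Measure ℝ)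

/-- The Cauchy kernel with a pole off the real line as an element of `L²(ℝ)`. -/
noncomputable def cauchyLp (w : ℂ) (hw : w.im ≠ 0) : L2Line := (memLp_cauchyKernel hw).toLp

theorem inner_cauchyLp (w : ℂ) (hw : w.im ≠ 0) (f : L2Line) :
    inner ℂ (cauchyLp w hw) f = cauchyTransform f ((starRingEnd ℂ) w) := by
  rw [L2.inner_def, cauchyTransform]
  refine integral_congr_ae ?_
  filter_upwards [(memLp_cauchyKernel hw).coeFn_toLp] with y hy
  rw [cauchyLp, hy]
  simp [RCLike.inner_apply, cauchyKernel]

/-- The Hardy space of the lower half plane: the closed span of the Cauchy kernels with poles in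
the upper half plane. -/
noncomputable def hardySpace : Submodule ℂ L2Line :=
  (Submodule.span ℂ {g | ∃ (w : ℂ) (hw : 0 < w.im), g = cauchyLp w hw.ne'}).topologicalClosure

instance : CompleteSpace hardySpace := by
  unfold hardySpace; infer_instance

/-- The Hilbert transformation `p.v. ∫ u(y) / (iπ (x - y)) dy` of the line, encoded as the
reflection that fixes `hardySpace` and is `-1` on the orthogonal complement, the opposite Hardy
space. -/
noncomputable def lineHilbert : L2Line ≃ₗᵢ[ℂ] L2Line := hardySpace.reflection

theorem lineHilbert_cauchyLp_of_pos {w : ℂ} (hw : 0 < w.im) :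
    lineHilbert (cauchyLp w hw.ne') = cauchyLp w hw.ne' :=
  Submodule.reflection_mem_subspace_eq_self
    (Submodule.le_topologicalClosure _ (Submodule.subset_span ⟨w, hw, rfl⟩))

/-- Cauchy kernels with poles in different half planes are orthogonal. -/
theorem lineHilbert_cauchyLp_of_neg {w : ℂ} (hw : w.im < 0) :
    lineHilbert (cauchyLp w hw.ne) = -cauchyLp w hw.ne := by
  refine Submodule.reflection_mem_subspace_orthogonalComplement_eq_neg ?_
  rw [hardySpace, Submodule.orthogonal_closure, Submodule.mem_orthogonal]
  intro g hg
  induction hg using Submodule.span_induction with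
  | mem g hg =>
    obtain ⟨v, hv, rfl⟩ := hg
    rw [inner_cauchyLp, cauchyTransform]
    have hv' : ((starRingEnd ℂ) v).im < 0 := by simpa using hv
    rw [← integral_cauchyKernel_mul_cauchyKernel hw hv']
    refine integral_congr_ae ?_
    filter_upwards [(memLp_cauchyKernel hw.ne).coeFn_toLp] with y hy
    rw [cauchyLp, hy]
  | zero => simp
  | add g₁ g₂ _ _ h₁ h₂ => rw [inner_add_left, h₁, h₂, add_zero]
  | smul c g _ h => rw [inner_smul_left, h, mul_zero]

theorem inner_lineHilbert_left (f g : L2Line) :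
    inner ℂ (lineHilbert f) g = inner ℂ f (lineHilbert g) := by
  conv_rhs => rw [← lineHilbert.inner_map_map]
  congr 1
  exact (hardySpace.reflection_reflection g).symm

theorem cauchyTransform_lineHilbert_of_pos (f : L2Line) {z : ℂ} (hz : 0 < z.im) :
    cauchyTransform (lineHilbert f) z = -cauchyTransform f z := by
  have hz' : ((starRingEnd ℂ) z).im < 0 := by simpa using hz
  have h := inner_lineHilbert_left (cauchyLp _ hz'.ne) f
  rw [lineHilbert_cauchyLp_of_neg hz', inner_neg_left, inner_cauchyLp, inner_cauchyLp,
    Complex.conj_conj] at h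
  exact h.symm

theorem cauchyTransform_lineHilbert_of_neg (f : L2Line) {z : ℂ} (hz : z.im < 0) :
    cauchyTransform (lineHilbert f) z = cauchyTransform f z := by
  have hz' : 0 < ((starRingEnd ℂ) z).im := by simpa using hz
  have h := inner_lineHilbert_left (cauchyLp _ hz'.ne') f
  rw [lineHilbert_cauchyLp_of_pos hz', inner_cauchyLp, inner_cauchyLp,
    Complex.conj_conj] at h
  exact h.symm

theorem ae_isPoissonPoint {f : ℝ → ℂ} (hf : MemLp f 2) : ∀ᵐ x, IsPoissonPoint f x :=
  ae_tendsto_lintegral_enorm_sub_mul_poissonLine hf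

/-- The mean of the boundary values of the Cauchy integral of `f` from both sides is a multiple
of `lineHilbert f`, by the jump relation for `lineHilbert f`. -/
theorem tendsto_cauchyTransform_add {f : L2Line} {x : ℝ}
    (hx : IsPoissonPoint (lineHilbert f) x) :
    Tendsto (fun ε => (cauchyTransform f ⟨x, ε⟩ + cauchyTransform f ⟨x, -ε⟩) / 2) (𝓝[>] 0)
      (𝓝 (-(Complex.I * Real.pi * lineHilbert f x))) := by
  have h := (hx.tendsto_cauchyTransform_sub (Lp.memLp _)).const_mul (-(2 : ℂ)⁻¹)
  have h2 : -(2 : ℂ)⁻¹ * (2 * Real.pi * Complex.I * lineHilbert f x) =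
      -(Complex.I * Real.pi * lineHilbert f x) := by ring
  rw [h2] at h
  refine h.congr' ?_
  filter_upwards [self_mem_nhdsWithin] with ε hε
  have hε' : 0 < ε := hε
  rw [cauchyTransform_lineHilbert_of_pos f (z := ⟨x, ε⟩) hε',
    cauchyTransform_lineHilbert_of_neg f (z := ⟨x, -ε⟩) (neg_lt_zero.2 hε')]
  ring

/-! ### The finite Hilbert transformation -/

section Interval

variable (a b : ℝ)

/-- Restriction of square integrable functions from the line to the interval. Its adjoint is the
extension by zero. -/
noncomputable def restrictInterval : L2Line →L[ℂ] L2Interval a b :=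
  LpToLpRestrictCLM ℝ ℂ ℂ volume 2 (Ioo a b)

/-- The finite Hilbert transformation: the compression of the Hilbert transformation of the
line to the interval. -/
noncomputable def finiteHilbert : L2Interval a b →L[ℂ] L2Interval a b :=
  restrictInterval a b ∘L lineHilbert.toContinuousLinearEquiv.toContinuousLinearMap ∘L
    (restrictInterval a b).adjoint

theorem finiteHilbert_apply (u : L2Interval a b) :
    finiteHilbert a b u = restrictInterval a b (lineHilbert ((restrictInterval a b).adjoint u)) :=
  rfl

theorem isSymmetric_finiteHilbert : (finiteHilbert a b).IsSymmetric := by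
  intro u v
  change inner ℂ (finiteHilbert a b u) v = inner ℂ u (finiteHilbert a b v)
  rw [finiteHilbert_apply, finiteHilbert_apply, ← ContinuousLinearMap.adjoint_inner_right,
    inner_lineHilbert_left, ContinuousLinearMap.adjoint_inner_left]

theorem norm_restrictInterval_le : ‖restrictInterval a b‖ ≤ 1 := by
  refine ContinuousLinearMap.opNorm_le_bound _ zero_le_one fun f => ?_
  rw [one_mul, Lp.norm_def, Lp.norm_def]
  refine ENNReal.toReal_mono (Lp.eLpNorm_ne_top f) ?_
  rw [restrictInterval, eLpNorm_congr_ae (LpToLpRestrictCLM_coeFn ℂ (Ioo a b) f)]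
  exact eLpNorm_restrict_le _ _ _ _

theorem norm_finiteHilbert_le : ‖finiteHilbert a b‖ ≤ 1 := by
  refine ContinuousLinearMap.opNorm_le_bound _ zero_le_one fun u => ?_
  have h1 := norm_restrictInterval_le a b
  have h2 : ‖(restrictInterval a b).adjoint‖ ≤ 1 := by
    rwa [LinearIsometryEquiv.norm_map]
  rw [finiteHilbert_apply, one_mul]
  calc _ ≤ 1 * ‖lineHilbert ((restrictInterval a b).adjoint u)‖ :=
        ContinuousLinearMap.le_of_opNorm_le _ h1 _
    _ = ‖(restrictInterval a b).adjoint u‖ := by rw [one_mul, LinearIsometryEquiv.norm_map]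
    _ ≤ 1 * ‖u‖ := ContinuousLinearMap.le_of_opNorm_le _ h2 _
    _ = ‖u‖ := one_mul _

variable {a b}

theorem coeFn_adjoint_restrictInterval (u : L2Interval a b) :
    (restrictInterval a b).adjoint u =ᵐ[volume] (Ioo a b).indicator u := by
  have hm : MemLp ((Ioo a b).indicator u) 2 volume :=
    (memLp_indicator_iff_restrict measurableSet_Ioo).2 (Lp.memLp u)
  have h : (restrictInterval a b).adjoint u = hm.toLp := by
    refine ext_inner_left ℂ fun g => ?_
    rw [ContinuousLinearMap.adjoint_inner_right, L2.inner_def, L2.inner_def]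
    have h1 : ∫ x, inner ℂ (restrictInterval a b g x) (u x) ∂(volume.restrict (Ioo a b)) =
        ∫ x in Ioo a b, inner ℂ (g x) (u x) := by
      refine integral_congr_ae ?_
      filter_upwards [LpToLpRestrictCLM_coeFn ℂ (Ioo a b) g] with x hx
      rw [restrictInterval, hx]
    rw [h1, ← integral_indicator measurableSet_Ioo]
    refine integral_congr_ae ?_
    filter_upwards [hm.coeFn_toLp] with x hx
    rw [hx]
    by_cases hx' : x ∈ Ioo a b
    · rw [indicator_of_mem hx', indicator_of_mem hx']
    · rw [indicator_of_notMem hx', indicator_of_notMem hx', inner_zero_right]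
  rw [h]
  exact hm.coeFn_toLp

theorem cauchyTransform_adjoint_restrictInterval (u : L2Interval a b) (z : ℂ) :
    cauchyTransform ((restrictInterval a b).adjoint u) z =
      ∫ y in Ioo a b, u y * cauchyKernel z y := by
  rw [cauchyTransform, ← integral_indicator measurableSet_Ioo]
  refine integral_congr_ae ?_
  filter_upwards [coeFn_adjoint_restrictInterval u] with y hy
  rw [hy]
  by_cases hy' : y ∈ Ioo a b
  · rw [indicator_of_mem hy', indicator_of_mem hy']
  · rw [indicator_of_notMem hy', indicator_of_notMem hy', zero_mul]

/-- The finite Hilbert transform is the mean of the boundary values of the Cauchy integral from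
both sides, up to a factor. -/
theorem ae_tendsto_cauchyTransform_add (u : L2Interval a b) :
    ∀ᵐ x ∂(volume.restrict (Ioo a b)), Tendsto (fun ε : ℝ =>
      ((∫ y in Ioo a b, u y * cauchyKernel ⟨x, ε⟩ y) +
        ∫ y in Ioo a b, u y * cauchyKernel ⟨x, -ε⟩ y) / 2) (𝓝[>] 0)
      (𝓝 (-(Complex.I * Real.pi * finiteHilbert a b u x))) := by
  set f := (restrictInterval a b).adjoint u with hf
  filter_upwards [ae_restrict_of_ae (ae_isPoissonPoint (Lp.memLp (lineHilbert f))),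
    LpToLpRestrictCLM_coeFn ℂ (Ioo a b) (lineHilbert f)] with x h1 h2
  rw [finiteHilbert_apply, ← hf, restrictInterval, h2]
  simp_rw [← cauchyTransform_adjoint_restrictInterval]
  exact tendsto_cauchyTransform_add h1

theorem isFiniteHilbertTransform_finiteHilbert :
    IsFiniteHilbertTransform a b (finiteHilbert a b) := by
  intro u
  set f := (restrictInterval a b).adjoint u with hf
  filter_upwards [ae_tendsto_cauchyTransform_add u,
    ae_restrict_of_ae (ae_isPoissonPoint (Lp.memLp f))] with x h1 h2
  have h3 := (h2.tendsto_truncated_add (Lp.memLp f)).sub h1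
  simp_rw [← cauchyTransform_adjoint_restrictInterval, ← hf] at h3
  have h4 := h3.const_mul (Complex.I * Real.pi)⁻¹
  have hpi : (Real.pi : ℂ) ≠ 0 := by exact_mod_cast Real.pi_ne_zero
  have h5 : (Complex.I * (Real.pi : ℂ))⁻¹ * (0 - -(Complex.I * Real.pi * finiteHilbert a b u x)) =
      finiteHilbert a b u x := by
    have := Complex.I_ne_zero
    field_simp
    ring
  rw [h5] at h4
  refine h4.congr fun ε => ?_
  have hset : MeasurableSet {y : ℝ | ε < |x - y|} := measurableSet_lt (by fun_prop) (by fun_prop)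
  have hset2 : {y : ℝ | y ∈ Ioo a b ∧ ε < |x - y|} = {y : ℝ | ε < |x - y|} ∩ Ioo a b := by
    ext y; exact and_comm
  rw [add_sub_cancel_right, truncatedHilbert, hset2, ← setIntegral_indicator measurableSet_Ioo,
    ← integral_const_mul]
  refine integral_congr_ae ?_
  filter_upwards [ae_restrict_of_ae (coeFn_adjoint_restrictInterval u)] with y hy
  rw [hf, hy]
  by_cases hy' : y ∈ Ioo a b
  · rw [indicator_of_mem hy', indicator_of_mem hy', inv_mul_eq_div, div_div,
      mul_comm ((x : ℂ) - y)]
  · rw [indicator_of_notMem hy', indicator_of_notMem hy', zero_div, mul_zero]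

end Interval

/-! ### The Stieltjes transform of a power -/

theorem integrableOn_rpow_div_one_add {p : ℝ} (hp : p ∈ Ioo (-1 : ℝ) 0) :
    IntegrableOn (fun w : ℝ => w ^ p / (1 + w)) (Ioi 0) := by
  have hp' : p + 1 ∈ Ioo (0 : ℝ) 1 := ⟨by linarith [hp.1], by linarith [hp.2]⟩
  refine (Real.integrableOn_rpowIntegrand₀₁_Ioi hp' zero_le_one).congr_fun (fun w hw => ?_)
    measurableSet_Ioi
  simp only
  rw [Real.rpowIntegrand₀₁_eq_pow_div hp' (le_of_lt hw) zero_le_one, add_sub_cancel_right, mul_one,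
    add_comm]

theorem norm_ofReal_cpow {w : ℝ} (hw : 0 < w) (s : ℂ) : ‖(w : ℂ) ^ s‖ = w ^ s.re :=
  Complex.norm_cpow_eq_rpow_re_of_pos hw s

theorem measurable_ofReal_cpow (s : ℂ) : Measurable fun w : ℝ => (w : ℂ) ^ s :=
  Complex.measurable_ofReal.pow_const s

/-- The denominators `ρ + w`, `w > 0`, are of size at least `c (1 + w)`, locally uniformly for
`ρ` in the slit plane. -/
theorem exists_mul_one_add_le_norm_add {ρ₀ : ℂ} (hρ : ρ₀ ∈ Complex.slitPlane) :
    ∃ c > 0, ∃ r > 0, ∀ ρ ∈ Metric.ball ρ₀ r, ∀ w : ℝ, 0 ≤ w → c * (1 + w) ≤ ‖ρ + w‖ := by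
  obtain ⟨d, hd, hball⟩ := Metric.isOpen_iff.1 Complex.isOpen_slitPlane ρ₀ hρ
  have h1 : ∀ w : ℝ, 0 ≤ w → d ≤ ‖ρ₀ + w‖ := by
    intro w hw
    by_contra! hlt
    have hmem : -(w : ℂ) ∈ Metric.ball ρ₀ d := by
      rw [Metric.mem_ball, dist_comm, dist_eq_norm, sub_neg_eq_add]
      exact hlt
    have := Complex.neg_ofReal_mem_slitPlane.1 (hball hmem)
    linarith
  set M := ‖ρ₀‖ + d / 2 with hM
  have hM0 : 0 < M := by positivity
  refine ⟨(1 + 2 * (M + 1) / d)⁻¹, by positivity, d / 2, by positivity, fun ρ hρ w hw => ?_⟩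
  rw [Metric.mem_ball, dist_eq_norm] at hρ
  have h2 : d / 2 ≤ ‖ρ + w‖ := by
    have h3 : ‖ρ₀ + w‖ ≤ ‖ρ + w‖ + ‖ρ - ρ₀‖ := by
      have : ρ₀ + w = (ρ + w) - (ρ - ρ₀) := by ring
      rw [this]; exact norm_sub_le _ _
    linarith [h1 w hw]
  have h4 : w ≤ ‖ρ + w‖ + M := by
    have h5 : ‖(w : ℂ)‖ ≤ ‖ρ + w‖ + ‖ρ‖ := by
      have : (w : ℂ) = (ρ + w) - ρ := by ring
      rw [this]
      simpa using norm_sub_le (ρ + w) ρ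
    have h6 : ‖ρ‖ ≤ ‖ρ₀‖ + ‖ρ - ρ₀‖ := by
      have : ρ = ρ₀ + (ρ - ρ₀) := by ring
      conv_lhs => rw [this]
      exact norm_add_le _ _
    rw [Complex.norm_real, Real.norm_of_nonneg hw] at h5
    linarith
  rw [inv_mul_le_iff₀ (by positivity)]
  have h7 : M + 1 ≤ 2 * (M + 1) / d * ‖ρ + w‖ := by
    calc M + 1 = 2 * (M + 1) / d * (d / 2) := by field_simp
      _ ≤ _ := by gcongr
  linarith

/-- The Stieltjes transform `∫ w ^ s / (ρ + w) dw` of a power on the half line. -/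
noncomputable def stieltjesPow (s ρ : ℂ) : ℂ := ∫ w : ℝ in Ioi 0, (w : ℂ) ^ s / (ρ + w)

section Stieltjes

variable {s : ℂ}

theorem aestronglyMeasurable_cpow_div (s ρ : ℂ) (n : ℕ) :
    AEStronglyMeasurable (fun w : ℝ => (w : ℂ) ^ s / (ρ + w) ^ n) (volume.restrict (Ioi 0)) :=
  ((measurable_ofReal_cpow s).div
    ((measurable_const.add Complex.measurable_ofReal).pow_const n)).aestronglyMeasurable

theorem integrableOn_cpow_div_add (hs : s.re ∈ Ioo (-1 : ℝ) 0) {ρ : ℂ}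
    (hρ : ρ ∈ Complex.slitPlane) :
    IntegrableOn (fun w : ℝ => (w : ℂ) ^ s / (ρ + w)) (Ioi 0) := by
  obtain ⟨c, hc, r, hr, h⟩ := exists_mul_one_add_le_norm_add hρ
  refine ((integrableOn_rpow_div_one_add hs).const_mul c⁻¹).mono'
    (by simpa using aestronglyMeasurable_cpow_div s ρ 1) ?_
  filter_upwards [ae_restrict_mem measurableSet_Ioi] with w hw
  have hw0 : 0 < w := hw
  rw [norm_div, norm_ofReal_cpow hw0]
  calc w ^ s.re / ‖ρ + w‖ ≤ w ^ s.re / (c * (1 + w)) := by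
        gcongr
        exact h ρ (Metric.mem_ball_self hr) w hw0.le
    _ = _ := by field_simp

theorem differentiableOn_stieltjesPow (hs : s.re ∈ Ioo (-1 : ℝ) 0) :
    DifferentiableOn ℂ (stieltjesPow s) Complex.slitPlane := by
  intro ρ₀ hρ₀
  obtain ⟨c, hc, r, hr, h⟩ := exists_mul_one_add_le_norm_add hρ₀
  have hne : ∀ ρ ∈ Metric.ball ρ₀ r, ∀ w : ℝ, 0 < w → ρ + w ≠ 0 := fun ρ hρ w hw => by
    rw [← norm_pos_iff]
    exact (mul_pos hc (by positivity)).trans_le (h ρ hρ w hw.le)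
  have key := hasDerivAt_integral_of_dominated_loc_of_deriv_le (μ := volume.restrict (Ioi (0 : ℝ)))
    (F := fun (ρ : ℂ) (w : ℝ) => (w : ℂ) ^ s / (ρ + w))
    (F' := fun (ρ : ℂ) (w : ℝ) => -((w : ℂ) ^ s / (ρ + w) ^ 2))
    (bound := fun w => (c ^ 2)⁻¹ * (w ^ s.re / (1 + w))) (x₀ := ρ₀) (Metric.ball_mem_nhds ρ₀ hr)
    (.of_forall fun ρ => by simpa using aestronglyMeasurable_cpow_div s ρ 1)
    (integrableOn_cpow_div_add hs hρ₀) (aestronglyMeasurable_cpow_div s ρ₀ 2).neg ?_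
    ((integrableOn_rpow_div_one_add hs).const_mul _) ?_
  · exact key.2.differentiableAt.differentiableWithinAt
  · filter_upwards [ae_restrict_mem measurableSet_Ioi] with w hw ρ hρ
    have hw0 : 0 < w := hw
    rw [norm_neg, norm_div, norm_ofReal_cpow hw0, norm_pow]
    calc w ^ s.re / ‖ρ + w‖ ^ 2 ≤ w ^ s.re / (c * (1 + w)) ^ 2 := by
          gcongr
          exact h ρ hρ w hw0.le
      _ ≤ w ^ s.re / (c ^ 2 * (1 + w)) := by
          gcongr
          rw [mul_pow]
          gcongr
          nlinarith
      _ = _ := by field_simp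
  · filter_upwards [ae_restrict_mem measurableSet_Ioi] with w hw ρ hρ
    have h0 := hne ρ hρ w hw
    have := (hasDerivAt_const ρ ((w : ℂ) ^ s)).div ((hasDerivAt_id ρ).add_const (w : ℂ)) h0
    refine this.congr_deriv ?_
    simp
    ring

theorem stieltjesPow_ofReal {ρ : ℝ} (hρ : 0 < ρ) :
    stieltjesPow s ρ = (ρ : ℂ) ^ s * stieltjesPow s 1 := by
  have h := integral_comp_mul_left_Ioi (fun w : ℝ => (w : ℂ) ^ s / ((ρ : ℂ) + w)) 0 hρ
  have hρ' : (ρ : ℂ) ≠ 0 := by exact_mod_cast hρ.ne'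
  rw [mul_zero, eq_inv_smul_iff₀ hρ.ne'] at h
  rw [stieltjesPow, ← h, stieltjesPow, ← integral_const_mul, ← integral_smul]
  refine setIntegral_congr_fun measurableSet_Ioi fun w hw => ?_
  have hw0 : 0 < w := hw
  simp only [Complex.real_smul]
  push_cast
  rw [Complex.mul_cpow_ofReal_nonneg hρ.le hw0.le]
  have h1 : (ρ : ℂ) + ρ * w = ρ * (1 + w) := by ring
  rw [h1]
  have h2 : (1 + w : ℂ) ≠ 0 := by
    have : (1 + w : ℝ) ≠ 0 := by positivity
    exact_mod_cast this
  field_simp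

/-- By scaling on the positive half line and analytic continuation, the Stieltjes transform of a
power is a multiple of that power. -/
theorem stieltjesPow_eq (hs : s.re ∈ Ioo (-1 : ℝ) 0) {ρ : ℂ} (hρ : ρ ∈ Complex.slitPlane) :
    stieltjesPow s ρ = ρ ^ s * stieltjesPow s 1 := by
  have hf : AnalyticOnNhd ℂ (stieltjesPow s) Complex.slitPlane :=
    (differentiableOn_stieltjesPow hs).analyticOnNhd Complex.isOpen_slitPlane
  have hg : AnalyticOnNhd ℂ (fun ρ : ℂ => ρ ^ s * stieltjesPow s 1) Complex.slitPlane :=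
    DifferentiableOn.analyticOnNhd (fun z hz =>
      (((differentiableAt_id).cpow_const hz).mul_const _).differentiableWithinAt)
      Complex.isOpen_slitPlane
  have hconn : IsPreconnected Complex.slitPlane :=
    (Complex.starConvex_one_slitPlane.isPathConnected Complex.one_mem_slitPlane).isConnected.2
  refine hf.eqOn_of_preconnected_of_frequently_eq hg hconn Complex.one_mem_slitPlane ?_ hρ
  have ht : Tendsto (fun x : ℝ => (x : ℂ)) (𝓝[≠] 1) (𝓝[≠] 1) := by
    refine tendsto_nhdsWithin_iff.2 ⟨?_, ?_⟩
    · have := (Complex.continuous_ofReal.tendsto 1).mono_left (nhdsWithin_le_nhds (s := {1}ᶜ))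
      simpa using this
    · filter_upwards [self_mem_nhdsWithin] with x hx
      simpa using hx
  refine ht.frequently (Eventually.frequently ?_)
  filter_upwards [nhdsWithin_le_nhds (Ioi_mem_nhds (zero_lt_one' ℝ))] with x hx
  exact stieltjesPow_ofReal hx

end Stieltjes

/-! ### The substitution `y = (a + b w) / (1 + w)` -/

section Substitution

variable {a b : ℝ}

theorem image_moebius (hab : a < b) :
    (fun w : ℝ => (a + b * w) / (1 + w)) '' Ioi 0 = Ioo a b := by
  have hL : 0 < b - a := sub_pos.2 hab
  ext y
  constructor
  · rintro ⟨w, hw, rfl⟩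
    have hw0 : 0 < w := hw
    simp only [mem_Ioo]
    rw [lt_div_iff₀ (by positivity), div_lt_iff₀ (by positivity)]
    constructor <;> nlinarith
  · rintro ⟨h1, h2⟩
    have h3 : 0 < b - y := sub_pos.2 h2
    refine ⟨(y - a) / (b - y), div_pos (sub_pos.2 h1) h3, ?_⟩
    simp only
    have h4 : 1 + (y - a) / (b - y) = (b - a) / (b - y) := by field_simp; ring
    rw [h4]
    field_simp
    ring

theorem hasDerivAt_moebius {w : ℝ} (hw : 0 < w) :
    HasDerivAt (fun w : ℝ => (a + b * w) / (1 + w)) ((b - a) / (1 + w) ^ 2) w := by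
  have h := (((hasDerivAt_id w).const_mul b).const_add a).div ((hasDerivAt_id w).const_add 1)
    (by simp only [id]; positivity)
  refine h.congr_deriv ?_
  simp
  ring

theorem injOn_moebius (hab : a < b) : InjOn (fun w : ℝ => (a + b * w) / (1 + w)) (Ioi 0) := by
  intro w hw v hv h
  have hw0 : 0 < w := hw
  have hv0 : 0 < v := hv
  simp only at h
  rw [div_eq_div_iff (by positivity) (by positivity)] at h
  have h2 : (b - a) * (w - v) = 0 := by linarith
  rcases mul_eq_zero.1 h2 with h3 | h3 <;> linarith

theorem setIntegral_Ioo_eq_Ioi {E : Type*} [NormedAddCommGroup E] [NormedSpace ℝ E] (hab : a < b)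
    (g : ℝ → E) : ∫ y in Ioo a b, g y =
      ∫ w in Ioi 0, ((b - a) / (1 + w) ^ 2) • g ((a + b * w) / (1 + w)) := by
  rw [← image_moebius hab, integral_image_eq_integral_abs_deriv_smul measurableSet_Ioi
    (fun w hw => (hasDerivAt_moebius hw).hasDerivWithinAt) (injOn_moebius hab)]
  refine setIntegral_congr_fun measurableSet_Ioi fun w _ => ?_
  have : 0 < b - a := sub_pos.2 hab
  rw [abs_of_nonneg (by positivity)]

theorem integrableOn_Ioo_iff_Ioi {E : Type*} [NormedAddCommGroup E] [NormedSpace ℝ E] (hab : a < b)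
    (g : ℝ → E) : IntegrableOn g (Ioo a b) ↔
      IntegrableOn (fun w => ((b - a) / (1 + w) ^ 2) • g ((a + b * w) / (1 + w))) (Ioi 0) := by
  rw [← image_moebius hab, integrableOn_image_iff_integrableOn_abs_deriv_smul measurableSet_Ioi
    (fun w hw => (hasDerivAt_moebius hw).hasDerivWithinAt) (injOn_moebius hab)]
  refine integrableOn_congr_fun (fun w _ => ?_) measurableSet_Ioi
  have : 0 < b - a := sub_pos.2 hab
  rw [abs_of_nonneg (by positivity)]

theorem moebius_inverse (hab : a < b) {w : ℝ} (hw : 0 < w) :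
    ((a + b * w) / (1 + w) - a) / (b - (a + b * w) / (1 + w)) = w := by
  have hL : b - a ≠ 0 := (sub_pos.2 hab).ne'
  have h1 : (a + b * w) / (1 + w) - a = (b - a) * w / (1 + w) := by field_simp; ring
  have h2 : b - (a + b * w) / (1 + w) = (b - a) / (1 + w) := by field_simp; ring
  rw [h1, h2]
  field_simp

end Substitution

/-! ### Approximate eigenfunctions of the finite Hilbert transformation -/

/-- The function `((y - a) / (b - y)) ^ s` on `(a, b)`. It is square integrable for
`|Re s| < 1 / 2`; only `-1 / 2 < Re s < 0` is used. Values off `(a, b)` do not matter. -/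
noncomputable def edgePow (a b : ℝ) (s : ℂ) (y : ℝ) : ℂ := (((y - a) / (b - y) : ℝ) : ℂ) ^ s

section EdgePow

variable {a b : ℝ} {s : ℂ}

theorem measurable_edgePow : Measurable (edgePow a b s) :=
  (measurable_ofReal_cpow s).comp (by fun_prop)

theorem norm_edgePow_sq {y : ℝ} (hy : y ∈ Ioo a b) :
    ‖edgePow a b s y‖ ^ 2 = ((y - a) / (b - y)) ^ (2 * s.re) := by
  have h : 0 < (y - a) / (b - y) := div_pos (sub_pos.2 hy.1) (sub_pos.2 hy.2)
  rw [edgePow, norm_ofReal_cpow h, ← Real.rpow_natCast, ← Real.rpow_mul h.le, mul_comm]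
  norm_num

theorem integrableOn_norm_edgePow_sq_moebius (hs : s.re ∈ Ioo (-1 / 2 : ℝ) 0) :
    IntegrableOn (fun w : ℝ => (b - a) / (1 + w) ^ 2 * w ^ (2 * s.re)) (Ioi 0) := by
  have hp : 2 * s.re ∈ Ioo (-1 : ℝ) 0 := ⟨by linarith [hs.1], by linarith [hs.2]⟩
  refine ((integrableOn_rpow_div_one_add hp).const_mul |b - a|).mono'
    (by fun_prop) ?_
  filter_upwards [ae_restrict_mem measurableSet_Ioi] with w hw
  have hw0 : 0 < w := hw
  rw [norm_mul, norm_div, Real.norm_eq_abs, Real.norm_of_nonneg (by positivity),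
    Real.norm_of_nonneg (by positivity)]
  calc |b - a| / (1 + w) ^ 2 * w ^ (2 * s.re) ≤ |b - a| / (1 + w) * w ^ (2 * s.re) := by
        gcongr
        nlinarith
    _ = _ := by ring

theorem integrableOn_norm_edgePow_sq (hab : a < b) (hs : s.re ∈ Ioo (-1 / 2 : ℝ) 0) :
    IntegrableOn (fun y => ‖edgePow a b s y‖ ^ 2) (Ioo a b) := by
  rw [integrableOn_congr_fun (fun y hy => norm_edgePow_sq hy) measurableSet_Ioo,
    integrableOn_Ioo_iff_Ioi hab]
  refine (integrableOn_norm_edgePow_sq_moebius (a := a) (b := b) hs).congr_fun (fun w hw => ?_)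
    measurableSet_Ioi
  simp only [smul_eq_mul]
  rw [moebius_inverse hab hw]

theorem memLp_edgePow (hab : a < b) (hs : s.re ∈ Ioo (-1 / 2 : ℝ) 0) :
    MemLp (edgePow a b s) 2 (volume.restrict (Ioo a b)) :=
  (memLp_two_iff_integrable_sq_norm measurable_edgePow.aestronglyMeasurable).2
    (integrableOn_norm_edgePow_sq hab hs)

/-- The norm of `edgePow` blows up as `Re s` decreases to `-1 / 2`. -/
theorem le_norm_sq_edgePow (hab : a < b) (hs : s.re ∈ Ioo (-1 / 2 : ℝ) 0) :
    (b - a) / 4 / (2 * s.re + 1) ≤ ‖(memLp_edgePow hab hs).toLp‖ ^ 2 := by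
  have hL : 0 < b - a := sub_pos.2 hab
  have hp : -1 < 2 * s.re := by linarith [hs.1]
  have hnorm : ‖(memLp_edgePow hab hs).toLp‖ ^ 2 = ∫ y in Ioo a b, ‖edgePow a b s y‖ ^ 2 := by
    set f : L2Interval a b := (memLp_edgePow hab hs).toLp
    have h := inner_self_eq_norm_sq_to_K (𝕜 := ℂ) f
    rw [L2.inner_def] at h
    have h2 : ∫ y, inner ℂ (f y) (f y) ∂(volume.restrict (Ioo a b)) =
        ∫ y in Ioo a b, ((‖edgePow a b s y‖ ^ 2 : ℝ) : ℂ) := by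
      refine integral_congr_ae ?_
      filter_upwards [(memLp_edgePow hab hs).coeFn_toLp] with y hy
      rw [hy, inner_self_eq_norm_sq_to_K]
      simp
    rw [h2, integral_complex_ofReal] at h
    exact Complex.ofReal_injective (by simpa using h.symm)
  rw [hnorm, setIntegral_congr_fun measurableSet_Ioo (fun y hy => norm_edgePow_sq hy),
    setIntegral_Ioo_eq_Ioi hab]
  have h1 : ∫ w in Ioi (0 : ℝ), ((b - a) / (1 + w) ^ 2) •
      (((a + b * w) / (1 + w) - a) / (b - (a + b * w) / (1 + w))) ^ (2 * s.re) =
      ∫ w in Ioi (0 : ℝ), (b - a) / (1 + w) ^ 2 * w ^ (2 * s.re) :=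
    setIntegral_congr_fun measurableSet_Ioi fun w hw => by
      simp only [smul_eq_mul]
      rw [moebius_inverse hab hw]
  rw [h1]
  have hint := integrableOn_norm_edgePow_sq_moebius (a := a) (b := b) hs
  calc (b - a) / 4 / (2 * s.re + 1) = ∫ w in Ioc (0 : ℝ) 1, (b - a) / 4 * w ^ (2 * s.re) := by
        rw [integral_const_mul, ← intervalIntegral.integral_of_le zero_le_one,
          integral_rpow (Or.inl hp), Real.one_rpow, Real.zero_rpow (by linarith)]
        ring
    _ ≤ ∫ w in Ioc (0 : ℝ) 1, (b - a) / (1 + w) ^ 2 * w ^ (2 * s.re) := by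
        refine setIntegral_mono_on ?_ (hint.mono_set Ioc_subset_Ioi_self) measurableSet_Ioc ?_
        · refine Integrable.const_mul ?_ _
          exact (intervalIntegrable_iff_integrableOn_Ioc_of_le zero_le_one).1
            (intervalIntegral.intervalIntegrable_rpow' hp)
        · intro w hw
          have hw0 : 0 < w := hw.1
          gcongr
          nlinarith [hw.2]
    _ ≤ _ := by
        refine setIntegral_mono_set hint ?_ Ioc_subset_Ioi_self.eventuallyLE
        filter_upwards [ae_restrict_mem measurableSet_Ioi] with w hw
        have hw0 : 0 < w := hw
        simp only [Pi.zero_apply]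
        positivity

theorem moebius_mem_slitPlane {z : ℂ} (hz : z.im ≠ 0) :
    (z - a) / (z - b) ∈ Complex.slitPlane := by
  rw [Complex.mem_slitPlane_iff]
  by_contra! hcon
  have hzb : z - b ≠ 0 := fun h => hz (by simpa using congrArg Complex.im h)
  have h1 : z - a = (z - a) / (z - b) * (z - b) := by field_simp
  have h2 := congrArg Complex.im h1
  rw [Complex.mul_im, hcon.2] at h2
  simp only [Complex.sub_im, Complex.ofReal_im, sub_zero, zero_mul, add_zero] at h2
  have h3 : (1 - ((z - a) / (z - b)).re) * z.im = 0 := by linarith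
  rcases mul_eq_zero.1 h3 with h | h
  · linarith [hcon.1]
  · exact hz h

/-- The Cauchy integral of `edgePow`: the substitution `w = (y - a) / (b - y)` turns it into a
difference of two Stieltjes transforms. -/
theorem setIntegral_edgePow_mul_cauchyKernel (hab : a < b) (hs : s.re ∈ Ioo (-1 / 2 : ℝ) 0)
    {z : ℂ} (hz : z.im ≠ 0) :
    ∫ y in Ioo a b, edgePow a b s y * cauchyKernel z y =
      (((z - a) / (z - b)) ^ s - 1) * stieltjesPow s 1 := by
  have hs' : s.re ∈ Ioo (-1 : ℝ) 0 := ⟨by linarith [hs.1], hs.2⟩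
  have hρ := moebius_mem_slitPlane (a := a) (b := b) hz
  have hzb : z - b ≠ 0 := fun h => hz (by simpa using congrArg Complex.im h)
  set ρ := (z - a) / (z - b) with hρdef
  rw [sub_mul, one_mul, ← stieltjesPow_eq hs' hρ]
  rw [stieltjesPow, stieltjesPow, ← integral_sub (integrableOn_cpow_div_add hs' hρ)
    (integrableOn_cpow_div_add hs' Complex.one_mem_slitPlane), setIntegral_Ioo_eq_Ioi hab]
  refine setIntegral_congr_fun measurableSet_Ioi fun w hw => ?_
  have hw0 : 0 < w := hw
  simp only [edgePow, cauchyKernel]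
  rw [moebius_inverse hab hw0, Complex.real_smul]
  have h1 : (1 + w : ℂ) ≠ 0 := by
    have : (1 + w : ℝ) ≠ 0 := by positivity
    exact_mod_cast this
  have h2 : ρ + w ≠ 0 := by
    intro h
    have h3 : ρ = -(w : ℂ) := eq_neg_of_add_eq_zero_left h
    rw [h3, Complex.neg_ofReal_mem_slitPlane] at hρ
    linarith
  have h4 : (((a + b * w) / (1 + w) : ℝ) : ℂ) - z = -((z - b) * (ρ + w)) / (1 + w) := by
    rw [hρdef]
    push_cast
    field_simp
    ring
  have h5 : (b - a : ℂ) = (ρ - 1) * (z - b) := by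
    rw [hρdef]
    field_simp
    ring
  rw [h4]
  push_cast
  rw [h5]
  field_simp
  ring

theorem moebius_im (x ε : ℝ) :
    (((⟨x, ε⟩ : ℂ) - a) / ((⟨x, ε⟩ : ℂ) - b)).im =
      -(ε * (b - a)) / Complex.normSq ((⟨x, ε⟩ : ℂ) - b) := by
  rw [Complex.div_im]
  simp
  ring

/-- As `z` tends to a point of `(a, b)`, the quotient `(z - a) / (z - b)` tends to the cut of the
logarithm, from below for `z` in the upper half plane and from above otherwise. -/
theorem tendsto_moebius_cpow {x : ℝ} (hx : x ∈ Ioo a b) (s : ℂ) :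
    Tendsto (fun ε : ℝ => (((⟨x, ε⟩ : ℂ) - a) / ((⟨x, ε⟩ : ℂ) - b)) ^ s) (𝓝[>] 0)
        (𝓝 (edgePow a b s x * Complex.exp (-(Real.pi * Complex.I * s)))) ∧
      Tendsto (fun ε : ℝ => (((⟨x, -ε⟩ : ℂ) - a) / ((⟨x, -ε⟩ : ℂ) - b)) ^ s) (𝓝[>] 0)
        (𝓝 (edgePow a b s x * Complex.exp (Real.pi * Complex.I * s))) := by
  set w := (x - a) / (b - x) with hw
  have hw0 : 0 < w := div_pos (sub_pos.2 hx.1) (sub_pos.2 hx.2)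
  have hL : 0 < b - a := by linarith [hx.1, hx.2]
  have hbx : 0 < b - x := sub_pos.2 hx.2
  set q : ℝ → ℂ := fun ε => ((⟨x, ε⟩ : ℂ) - a) / ((⟨x, ε⟩ : ℂ) - b) with hq
  have hden : ∀ ε : ℝ, (⟨x, ε⟩ : ℂ) - b ≠ 0 := fun ε h => by
    have := congrArg Complex.re h
    simp at this
    linarith
  have hq0 : q 0 = ((-w : ℝ) : ℂ) := by
    have h1 : (⟨x, 0⟩ : ℂ) = (x : ℂ) := rfl
    have h2 : (x : ℂ) - b ≠ 0 := by rw [← h1]; exact hden 0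
    have h3 : (b : ℂ) - x ≠ 0 := by rw [← neg_sub]; exact neg_ne_zero.2 h2
    simp only [hq, hw, h1]
    push_cast
    rw [← neg_sub (b : ℂ) x, div_neg]
  have hcont : Continuous q := by
    have h1 : Continuous fun ε : ℝ => (⟨x, ε⟩ : ℂ) := by
      have : (fun ε : ℝ => (⟨x, ε⟩ : ℂ)) = fun ε : ℝ => (x : ℂ) + ε * Complex.I := by
        ext ε
        apply Complex.ext <;> simp
      rw [this]
      fun_prop
    exact (h1.sub continuous_const).div (h1.sub continuous_const) hden
  have hqne : ∀ ε : ℝ, q ε ≠ 0 := fun ε => div_ne_zero (fun h => by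
    have := congrArg Complex.re h
    simp at this
    linarith [hx.1]) (hden ε)
  have hre : (((-w : ℝ) : ℂ)).re < 0 := by simpa using hw0
  have him : (((-w : ℝ) : ℂ)).im = 0 := by simp
  have hnorm : ‖((-w : ℝ) : ℂ)‖ = w := by
    rw [Complex.norm_real, norm_neg, Real.norm_of_nonneg hw0.le]
  have hexp : ∀ θ : ℂ, edgePow a b s x * Complex.exp (θ * s) =
      Complex.exp (((Real.log w : ℂ) + θ) * s) := by
    intro θ
    have : (w : ℂ) ≠ 0 := by exact_mod_cast hw0.ne'
    rw [edgePow, ← hw, Complex.cpow_def_of_ne_zero this, ← Complex.exp_add,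
      Complex.ofReal_log hw0.le, add_mul]
  have hnormSq : ∀ ε : ℝ, 0 < Complex.normSq ((⟨x, ε⟩ : ℂ) - b) := fun ε =>
    Complex.normSq_pos.2 (hden ε)
  constructor
  · have h1 : Tendsto q (𝓝[>] 0) (𝓝[{z | z.im < 0}] ((-w : ℝ) : ℂ)) := by
      refine tendsto_nhdsWithin_iff.2 ⟨?_, ?_⟩
      · rw [← hq0]
        exact (hcont.tendsto 0).mono_left nhdsWithin_le_nhds
      · filter_upwards [self_mem_nhdsWithin] with ε hε
        have hε' : 0 < ε := hε
        change (q ε).im < 0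
        rw [hq, moebius_im]
        exact div_neg_of_neg_of_pos (by nlinarith) (hnormSq ε)
    have h2 := (Complex.tendsto_log_nhdsWithin_im_neg_of_re_neg_of_im_zero hre him).comp h1
    rw [hnorm] at h2
    have h3 := (Complex.continuous_exp.tendsto _).comp (h2.mul_const s)
    rw [sub_eq_add_neg, ← hexp, neg_mul] at h3
    refine h3.congr fun ε => ?_
    exact (Complex.cpow_def_of_ne_zero (hqne ε) s).symm
  · have h1 : Tendsto (fun ε => q (-ε)) (𝓝[>] 0) (𝓝[{z | 0 ≤ z.im}] ((-w : ℝ) : ℂ)) := by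
      refine tendsto_nhdsWithin_iff.2 ⟨?_, ?_⟩
      · have h5 := ((hcont.comp continuous_neg).tendsto 0).mono_left
          (nhdsWithin_le_nhds (s := Ioi (0 : ℝ)))
        simp only [Function.comp, neg_zero, hq0] at h5
        exact h5
      · filter_upwards [self_mem_nhdsWithin] with ε hε
        have hε' : 0 < ε := hε
        change 0 ≤ (q (-ε)).im
        rw [hq, moebius_im]
        exact div_nonneg (by nlinarith) (hnormSq _).le
    have h2 := (Complex.tendsto_log_nhdsWithin_im_nonneg_of_re_neg_of_im_zero hre him).comp h1
    rw [hnorm] at h2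
    have h3 := (Complex.continuous_exp.tendsto _).comp (h2.mul_const s)
    rw [← hexp] at h3
    refine h3.congr fun ε => ?_
    exact (Complex.cpow_def_of_ne_zero (hqne (-ε)) s).symm

theorem setIntegral_toLp_mul_cauchyKernel {u : ℝ → ℂ}
    (hu : MemLp u 2 (volume.restrict (Ioo a b))) (z : ℂ) :
    ∫ y in Ioo a b, MemLp.toLp u hu y * cauchyKernel z y =
      ∫ y in Ioo a b, u y * cauchyKernel z y := by
  refine integral_congr_ae ?_
  filter_upwards [hu.coeFn_toLp] with y hy
  rw [hy]

theorem tendsto_setIntegral_edgePow (hab : a < b) (hs : s.re ∈ Ioo (-1 / 2 : ℝ) 0) {x : ℝ}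
    (hx : x ∈ Ioo a b) :
    Tendsto (fun ε : ℝ => ∫ y in Ioo a b, edgePow a b s y * cauchyKernel ⟨x, ε⟩ y) (𝓝[>] 0)
        (𝓝 ((edgePow a b s x * Complex.exp (-(Real.pi * Complex.I * s)) - 1) *
          stieltjesPow s 1)) ∧
      Tendsto (fun ε : ℝ => ∫ y in Ioo a b, edgePow a b s y * cauchyKernel ⟨x, -ε⟩ y) (𝓝[>] 0)
        (𝓝 ((edgePow a b s x * Complex.exp (Real.pi * Complex.I * s) - 1) *
          stieltjesPow s 1)) := by
  obtain ⟨h1, h2⟩ := tendsto_moebius_cpow hx s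
  constructor
  · refine ((h1.sub_const 1).mul_const (stieltjesPow s 1)).congr' ?_
    filter_upwards [self_mem_nhdsWithin] with ε hε
    exact (setIntegral_edgePow_mul_cauchyKernel hab hs (z := ⟨x, ε⟩) (ne_of_gt hε)).symm
  · refine ((h2.sub_const 1).mul_const (stieltjesPow s 1)).congr' ?_
    filter_upwards [self_mem_nhdsWithin] with ε hε
    exact (setIntegral_edgePow_mul_cauchyKernel hab hs (z := ⟨x, -ε⟩)
      (neg_ne_zero.2 (ne_of_gt hε))).symm

/-- The constant in the Stieltjes transform, read off from the jump of a Cauchy integral. -/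
theorem sin_mul_stieltjesPow_one (hs : s.re ∈ Ioo (-1 / 2 : ℝ) 0) :
    Complex.sin (Real.pi * s) * stieltjesPow s 1 = -Real.pi := by
  have hu := memLp_edgePow (s := s) zero_lt_one hs
  set f := (restrictInterval 0 1).adjoint hu.toLp with hf
  have hae : ∀ᵐ x ∂(volume.restrict (Ioo (0 : ℝ) 1)), x ∈ Ioo (0 : ℝ) 1 ∧ IsPoissonPoint f x ∧
      f x = edgePow 0 1 s x := by
    filter_upwards [ae_restrict_mem measurableSet_Ioo,
      ae_restrict_of_ae (ae_isPoissonPoint (Lp.memLp f)),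
      ae_restrict_of_ae (coeFn_adjoint_restrictInterval hu.toLp), hu.coeFn_toLp] with x h1 h2 h3 h4
    exact ⟨h1, h2, by rw [hf, h3, indicator_of_mem h1, h4]⟩
  have : NeBot (ae (volume.restrict (Ioo (0 : ℝ) 1))) := by
    rw [ae_neBot, Ne, Measure.restrict_eq_zero, Real.volume_Ioo]
    simp
  obtain ⟨x, hx, hxf, hfx⟩ := hae.exists
  have h1 := hxf.tendsto_cauchyTransform_sub (Lp.memLp f)
  simp only [hf, cauchyTransform_adjoint_restrictInterval, setIntegral_toLp_mul_cauchyKernel] at h1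
  obtain ⟨h2, h3⟩ := tendsto_setIntegral_edgePow zero_lt_one hs hx
  have h4 := tendsto_nhds_unique h1 (h2.sub h3)
  rw [← hf, hfx] at h4
  have hne : edgePow 0 1 s x ≠ 0 := by
    have h5 : 0 < (x - 0) / (1 - x) := div_pos (sub_pos.2 hx.1) (sub_pos.2 hx.2)
    rw [edgePow, Ne, Complex.cpow_eq_zero_iff, not_and_or]
    left
    exact_mod_cast h5.ne'
  have h6 : 2 * Real.pi * Complex.I =
      (Complex.exp (-(Real.pi * Complex.I * s)) - Complex.exp (Real.pi * Complex.I * s)) *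
        stieltjesPow s 1 := by
    apply mul_right_cancel₀ hne
    rw [h4]
    ring
  rw [Complex.sin]
  have h7 : -(Real.pi * s) * Complex.I = -(Real.pi * Complex.I * s) := by ring
  have h8 : (Real.pi * s) * Complex.I = Real.pi * Complex.I * s := by ring
  rw [h7, h8]
  have h9 : (Complex.exp (-(Real.pi * Complex.I * s)) - Complex.exp (Real.pi * Complex.I * s)) *
      Complex.I / 2 * stieltjesPow s 1 = (2 * Real.pi * Complex.I) * Complex.I / 2 := by
    rw [h6]; ring
  rw [h9]
  linear_combination Real.pi * Complex.I_mul_I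

/-- The functions `edgePow` are eigenfunctions up to an additive constant. -/
theorem finiteHilbert_edgePow (hab : a < b) (hs : s.re ∈ Ioo (-1 / 2 : ℝ) 0) :
    finiteHilbert a b (memLp_edgePow hab hs).toLp =
      (Complex.I / Complex.sin (Real.pi * s)) • (memLp_const (1 : ℂ)).toLp -
        (Complex.I * Complex.cos (Real.pi * s) / Complex.sin (Real.pi * s)) •
          (memLp_edgePow hab hs).toLp := by
  have hJ := sin_mul_stieltjesPow_one hs
  have hpi : (Real.pi : ℂ) ≠ 0 := by exact_mod_cast Real.pi_ne_zero
  have hsin : Complex.sin (Real.pi * s) ≠ 0 := by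
    intro h
    rw [h, zero_mul] at hJ
    exact hpi (neg_eq_zero.1 hJ.symm)
  set u := memLp_edgePow hab hs
  set one := memLp_const (μ := volume.restrict (Ioo a b)) (p := 2) (1 : ℂ)
  ext1
  filter_upwards [ae_restrict_mem measurableSet_Ioo, ae_tendsto_cauchyTransform_add u.toLp,
    u.coeFn_toLp, one.coeFn_toLp, Lp.coeFn_smul (Complex.I / Complex.sin (Real.pi * s)) one.toLp,
    Lp.coeFn_smul (Complex.I * Complex.cos (Real.pi * s) / Complex.sin (Real.pi * s)) u.toLp,
    Lp.coeFn_sub ((Complex.I / Complex.sin (Real.pi * s)) • one.toLp)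
      ((Complex.I * Complex.cos (Real.pi * s) / Complex.sin (Real.pi * s)) • u.toLp)]
    with x hx h1 h2 h3 h4 h5 h6
  rw [h6, Pi.sub_apply, h4, h5, Pi.smul_apply, Pi.smul_apply, h2, h3]
  simp only [setIntegral_toLp_mul_cauchyKernel] at h1
  obtain ⟨l1, l2⟩ := tendsto_setIntegral_edgePow hab hs hx
  have h7 := tendsto_nhds_unique h1 ((l1.add l2).div_const 2)
  have h8 : stieltjesPow s 1 = -Real.pi / Complex.sin (Real.pi * s) := by
    rw [eq_div_iff hsin, mul_comm]; exact hJ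
  have h9 : (Complex.exp (Real.pi * Complex.I * s) + Complex.exp (-(Real.pi * Complex.I * s))) / 2 =
      Complex.cos (Real.pi * s) := by
    rw [Complex.cos]
    congr 3 <;> ring_nf
  have h10 : -(Complex.I * Real.pi * finiteHilbert a b u.toLp x) =
      (edgePow a b s x * Complex.cos (Real.pi * s) - 1) *
        (-Real.pi / Complex.sin (Real.pi * s)) := by
    rw [h7, h8, ← h9]
    ring
  have hI := Complex.I_ne_zero
  have h11 : finiteHilbert a b u.toLp x = (Complex.I * Real.pi)⁻¹ *
      -((edgePow a b s x * Complex.cos (Real.pi * s) - 1) *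
        (-Real.pi / Complex.sin (Real.pi * s))) := by
    rw [← h10]
    field_simp
  rw [h11, smul_eq_mul, smul_eq_mul]
  field_simp
  rw [Complex.I_sq]
  ring

end EdgePow

/-! ### The spectrum of the finite Hilbert transformation -/

section Spectrum

variable {a b : ℝ}

/-- With `Re s` decreasing to `-1 / 2` along the line `Im s = ξ`, the functions `edgePow` become
approximate eigenfunctions, the additive constant being negligible against their norm. -/
theorem neg_tanh_mem_spectrum_finiteHilbert (hab : a < b) (ξ : ℝ) :
    ((-Real.tanh (Real.pi * ξ) : ℝ) : ℂ) ∈ spectrum ℂ (finiteHilbert a b) := by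
  intro hunit
  rw [spectrum.mem_resolventSet_iff] at hunit
  set κ : ℂ := ((-Real.tanh (Real.pi * ξ) : ℝ) : ℂ) with hκ
  set C := ‖resolvent (finiteHilbert a b) κ‖
  set one : L2Interval a b := (memLp_const (1 : ℂ)).toLp
  set σ : ℝ → ℂ := fun δ => ⟨-1 / 2 + δ, ξ⟩ with hσ
  have hσ0 : Real.pi * σ 0 = -(Real.pi / 2 : ℂ) + (Real.pi * ξ : ℝ) * Complex.I := by
    simp only [hσ]
    apply Complex.ext <;> simp
    ring
  have hcosh : Complex.cosh ((Real.pi * ξ : ℝ) : ℂ) ≠ 0 := by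
    rw [← Complex.ofReal_cosh]
    exact_mod_cast (Real.cosh_pos _).ne'
  have hsin0 : Complex.sin (Real.pi * σ 0) = -Complex.cosh ((Real.pi * ξ : ℝ) : ℂ) := by
    rw [hσ0, neg_add_eq_sub, Complex.sin_sub_pi_div_two, Complex.cos_mul_I]
  have hcos0 : Complex.cos (Real.pi * σ 0) =
      Complex.sinh ((Real.pi * ξ : ℝ) : ℂ) * Complex.I := by
    rw [hσ0, neg_add_eq_sub, Complex.cos_sub_pi_div_two, Complex.sin_mul_I]
  have hσcont : Continuous σ := by
    have : σ = fun δ : ℝ => ((-1 / 2 + δ : ℝ) : ℂ) + ξ * Complex.I := by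
      ext δ
      apply Complex.ext <;> simp [hσ]
    rw [this]
    fun_prop
  set η : ℝ → ℂ := fun δ => Complex.I / Complex.sin (Real.pi * σ δ) with hη
  set k : ℝ → ℂ := fun δ => -(Complex.I * Complex.cos (Real.pi * σ δ) /
    Complex.sin (Real.pi * σ δ)) with hk
  have hsinne : Complex.sin (Real.pi * σ 0) ≠ 0 := by rw [hsin0]; exact neg_ne_zero.2 hcosh
  have hsint : ContinuousAt (fun δ => Complex.sin (Real.pi * σ δ)) 0 :=
    (Complex.continuous_sin.comp (continuous_const.mul hσcont)).continuousAt
  have hcost : ContinuousAt (fun δ => Complex.cos (Real.pi * σ δ)) 0 :=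
    (Complex.continuous_cos.comp (continuous_const.mul hσcont)).continuousAt
  have hηt : Tendsto η (𝓝[>] 0) (𝓝 (η 0)) :=
    ((continuousAt_const.div hsint hsinne).tendsto).mono_left nhdsWithin_le_nhds
  have hk0 : k 0 = κ := by
    simp only [hk, hsin0, hcos0, hκ]
    push_cast
    rw [Complex.tanh_eq_sinh_div_cosh, ← Complex.ofReal_mul]
    field_simp
    rw [Complex.I_sq]
    ring
  have hkt : Tendsto k (𝓝[>] 0) (𝓝 κ) := by
    rw [← hk0]
    exact (((continuousAt_const.mul hcost).div hsint hsinne).neg.tendsto).mono_left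
      nhdsWithin_le_nhds
  -- A resolvent bound `C` turns the approximate eigenvalue equation into a bound for `‖u‖`, while
  -- `‖u‖ ^ 2` is at least of the order `1 / δ`.
  have hest : ∀ δ ∈ Ioo (0 : ℝ) (1 / 2), ∃ r : ℝ, 0 ≤ r ∧ (b - a) / 8 / δ ≤ r ^ 2 ∧
      r ≤ C * (‖κ - k δ‖ * r + ‖η δ‖ * ‖one‖) := by
    intro δ hδ
    have hs : (σ δ).re ∈ Ioo (-1 / 2 : ℝ) 0 :=
      ⟨by simp only [hσ]; linarith [hδ.1], by simp only [hσ]; linarith [hδ.2]⟩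
    set u : L2Interval a b := (memLp_edgePow hab hs).toLp with hu
    refine ⟨‖u‖, norm_nonneg _, ?_, ?_⟩
    · refine le_trans (le_of_eq ?_) (le_norm_sq_edgePow hab hs)
      have : 2 * (σ δ).re + 1 = 2 * δ := by simp only [hσ]; ring
      rw [this]
      have := hδ.1.ne'
      field_simp
      ring
    · refine (norm_le_norm_resolvent_mul hunit u).trans ?_
      refine mul_le_mul_of_nonneg_left ?_ (norm_nonneg _)
      have h1 : (algebraMap ℂ _ κ - finiteHilbert a b) u = (κ - k δ) • u - η δ • one := by
        have h2 : (algebraMap ℂ _ κ - finiteHilbert a b) u = κ • u - finiteHilbert a b u := by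
          simp [Algebra.algebraMap_eq_smul_one]
        rw [h2, hu, finiteHilbert_edgePow hab hs, ← hu]
        simp only [hk, hη]
        module
      rw [h1]
      refine (norm_sub_le _ _).trans ?_
      rw [norm_smul, norm_smul]
  have hlim1 : Tendsto (fun δ => C * ‖κ - k δ‖) (𝓝[>] 0) (𝓝 0) := by
    have := (tendsto_const_nhds (x := κ)).sub hkt |>.norm.const_mul C
    simpa using this
  have hL : 0 < b - a := sub_pos.2 hab
  have hlim2 : Tendsto (fun δ : ℝ => (C * (‖η δ‖ * ‖one‖)) ^ 2 * (8 / (b - a) * δ)) (𝓝[>] 0)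
      (𝓝 0) := by
    have h1 := ((hηt.norm.mul_const ‖one‖).const_mul C).pow 2
    have h2 : Tendsto (fun δ : ℝ => 8 / (b - a) * δ) (𝓝[>] 0) (𝓝 (8 / (b - a) * 0)) :=
      ((continuous_const.mul continuous_id).tendsto 0).mono_left nhdsWithin_le_nhds
    simpa using h1.mul h2
  have hsmall : ∀ᶠ δ : ℝ in 𝓝[>] 0, δ ∈ Ioo (0 : ℝ) (1 / 2) :=
    Ioo_mem_nhdsGT (by norm_num)
  obtain ⟨δ, hδ, h1, h2⟩ := (hsmall.and
    ((hlim1.eventually_lt_const (by norm_num : (0 : ℝ) < 1 / 2)).and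
      (hlim2.eventually_lt_const (by norm_num : (0 : ℝ) < 1 / 4)))).exists
  obtain ⟨r, hr0, hr1, hr2⟩ := hest δ hδ
  set B := C * (‖η δ‖ * ‖one‖) with hB
  have hB0 : 0 ≤ B := by positivity
  have h3 : r ≤ 2 * B := by
    have h4 : C * (‖κ - k δ‖ * r + ‖η δ‖ * ‖one‖) = C * ‖κ - k δ‖ * r + B := by rw [hB]; ring
    rw [h4] at hr2
    nlinarith
  have h5 : (b - a) / 8 / δ ≤ 4 * B ^ 2 := by
    calc _ ≤ r ^ 2 := hr1
      _ ≤ (2 * B) ^ 2 := by gcongr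
      _ = _ := by ring
  have hδ0 : 0 < δ := hδ.1
  have h6 : 1 ≤ 4 * (B ^ 2 * (8 / (b - a) * δ)) := by
    calc (1 : ℝ) = (b - a) / 8 / δ * (8 / (b - a) * δ) := by field_simp
      _ ≤ 4 * B ^ 2 * (8 / (b - a) * δ) := by gcongr
      _ = _ := by ring
  linarith

theorem unitSegment_subset_spectrum_finiteHilbert (hab : a < b) :
    unitSegment ⊆ spectrum ℂ (finiteHilbert a b) := by
  have hclosed : IsClosed {t : ℝ | (t : ℂ) ∈ spectrum ℂ (finiteHilbert a b)} :=
    (spectrum.isClosed (𝕜 := ℂ) (finiteHilbert a b)).preimage Complex.continuous_ofReal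
  have hsub : Ioo (-1 : ℝ) 1 ⊆ {t : ℝ | (t : ℂ) ∈ spectrum ℂ (finiteHilbert a b)} := by
    intro t ht
    have h := neg_tanh_mem_spectrum_finiteHilbert hab (Real.artanh (-t) / Real.pi)
    have ht' : -t ∈ Ioo (-1 : ℝ) 1 := ⟨by linarith [ht.2], by linarith [ht.1]⟩
    rw [mul_div_cancel₀ _ Real.pi_ne_zero, Real.tanh_artanh ht', neg_neg] at h
    exact h
  rintro _ ⟨t, ht, rfl⟩
  have h := closure_minimal hsub hclosed
  rw [closure_Ioo (by norm_num)] at h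
  exact h ht

theorem isUnit_sub_finiteHilbert_iff (hab : a < b) (lam : ℂ) :
    IsUnit (algebraMap ℂ _ lam - finiteHilbert a b) ↔ lam ∉ unitSegment :=
  ⟨fun h hlam => unitSegment_subset_spectrum_finiteHilbert hab hlam h,
    isUnit_algebraMap_sub_of_notMem (isSymmetric_finiteHilbert a b) (norm_finiteHilbert_le a b)⟩

end Spectrum

theorem isStableScheme_iff {a b : ℝ} (hab : a < b) (o : ℕ+ → ℝ) (lam : ℂ) :
    IsStableScheme a b o lam ↔ lam ∉ unitSegment :=
  ⟨notMem_unitSegment_of_isStableScheme hab, fun hlam =>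
    ⟨_, fun N => ⟨isUnit_algebraMap_sub_of_notMem (isSymmetric_schemeOperator a b (o N) N)
      norm_schemeOperator_le hlam, norm_resolvent_le_inv_infDist
        (isSymmetric_schemeOperator a b (o N) N) norm_schemeOperator_le hlam⟩⟩⟩

theorem proposition1 (a b : ℝ) (hab : a < b) (o : ℕ+ → ℝ) :
    (∀ N : ℕ+, (schemeMatrix a b (o N) N).IsHermitian ∧
      ∀ μ : ℂ, Module.End.HasEigenvalue (Matrix.toLin' (schemeMatrix a b (o N) N)) μ →
        μ ∈ unitSegment) ∧
    ∃ A : L2Interval a b →L[ℂ] L2Interval a b,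
      IsFiniteHilbertTransform a b A ∧
      ∀ lam : ℂ,
        (IsStableScheme a b o lam ↔ IsUnit (algebraMap ℂ _ lam - A)) ∧
        (IsUnit (algebraMap ℂ _ lam - A) ↔ lam ∉ unitSegment) ∧
        (lam ∉ unitSegment →
          (∀ N : ℕ+,
            IsUnit (algebraMap ℂ _ lam - schemeOperator a b (o N) N) ∧
              ‖resolvent (schemeOperator a b (o N) N) lam‖ ≤
                (Metric.infDist lam unitSegment)⁻¹) ∧
          (Metric.infDist lam unitSegment)⁻¹ = ‖resolvent A lam‖) := by
  refine ⟨fun N => ⟨isHermitian_schemeMatrix a b (o N) N,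
    fun μ => mem_unitSegment_of_hasEigenvalue⟩, finiteHilbert a b,
    isFiniteHilbertTransform_finiteHilbert, fun lam => ⟨?_, isUnit_sub_finiteHilbert_iff hab lam,
    fun hlam => ⟨fun N => ⟨?_, ?_⟩, le_antisymm ?_ ?_⟩⟩⟩
  · rw [isStableScheme_iff hab, isUnit_sub_finiteHilbert_iff hab]
  · exact isUnit_algebraMap_sub_of_notMem (isSymmetric_schemeOperator a b (o N) N)
      norm_schemeOperator_le hlam
  · exact norm_resolvent_le_inv_infDist (isSymmetric_schemeOperator a b (o N) N)
      norm_schemeOperator_le hlam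
  · exact inv_infDist_le_norm_resolvent ((isUnit_sub_finiteHilbert_iff hab lam).2 hlam)
      (unitSegment_subset_spectrum_finiteHilbert hab)
  · exact norm_resolvent_le_inv_infDist (isSymmetric_finiteHilbert a b)
      (norm_finiteHilbert_le a b) hlam
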